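/- **Setting.** Let $\mathsf X\subset\mathbb R^m$ be compact with its Borel $\sigma$-algebra, $\rho$ a finite measure on $\mathsf X$, $\mathcal S$ a countably infinite linearly ordered set, and $A,B_0:\mathsf X\to\mathbb R$, $B:\mathsf X\times\mathsf X\to\mathbb R$ bounded measurable functions with $B(x,y)=B(y,x)$ and $B(x,x)=B_0(x)$. Let $\theta_\star:\mathcal S\times\mathcal S\to\mathbb R$ be symmetric with $\sum_{\ell\ne s}|\theta_\star(s,\ell)|<\infty$ for every $s$, and put $\partial s=\{\ell\neq s:\theta_\star(s,\ell)\neq0\}$. Let $\mu_\star$ be a probability measure on $\mathsf X^{\mathcal S}$ under which, for every $s$, the conditional law of $X_s$ given $(X_\ell)_{\ell\ne s}$ has $\rho$-density proportional to $u\mapsto\exp\{A(u)+\theta_\star(s,s)B_0(u)+\sum_{\ell\ne s}\theta_\star(s,\ell)B(u,X_\ell)\}$; $\mathbb E_\star$ is expectation under $\mu_\star$. Let $X^{(1)},X^{(2)},\dots$ be i.i.d. with law $\mu_\star$. Let $D_n$ be finite subsets of $\mathcal S$ increasing to $\mathcal S$, $p_n=|D_n|$, and $\underline D_n^2=\{(s,\ell)\in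 D_n\times D_n:s\le\ell\}$. Let $\mathcal M^{(n)}$ be the space of symmetric matrices indexed by $D_n$ (extended by $0$ to $\mathcal S\times\mathcal S$), $\theta_\star^{(n)}\in\mathcal M^{(n)}$ the restriction of $\theta_\star$ to $D_n\times D_n$, and $\|\theta\|_2^2=\sum_{(s,\ell)\in\underline D_n^2}|\theta(s,\ell)|^2$. For $\theta\in\mathcal M^{(n)}$ and $s\in D_n$ let $$f^{(s)}_\theta(u\mid x_{D_n\setminus\{s\}})\propto\exp\Big\{A(u)+\theta(s,s)B_0(u)+\sum_{\ell\in D_n\setminus\{s\}}\theta(s,\ell)B(u,x_\ell)\Big\}$$ (a $\rho$-density in $u$), and let $\mathrm{Var}_\theta(\cdot\mid X_{D_n\setminus\{s\}})$ be the variance when $X_s$ has this density. Fix $K\in[0,\infty]$, not depending on $n$, and let $\mathcal M^{(n)}_K$ be the set of $\theta\in\mathcal M^{(n)}$ with $\sum_{\ell\in D_n}|\theta(s,\ell)|\le K$ for all $s\in D_n$ (so $\mathcal M^{(n)}_\infty=\mathcal M^{(n)}$). Assume $\theta_\star^{(n)}\in\mathcal M^{(n)}_K$ for all $n$. Let $q_\lambda:[0,\infty)\to[0,\infty)$,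 $\lambda\ge0$, be penalty functions with $q_\lambda(0)=0$, right-continuous at $0$, differentiable on $(0,\infty)$, and $\sup_{\lambda>0}\sup_{x>0}|q_\lambda'(x)|/\lambda<\infty$. Let $\lambda_n>0$, and for each $n\geq 1$ let $\hat\theta_n$ be a (measurable) random element which almost surely maximizes over $\mathcal M^{(n)}_K$ $$Q_n(\theta)=\sum_{i=1}^n\sum_{s\in D_n}\log f^{(s)}_\theta\big(X^{(i)}_s\mid X^{(i)}_{D_n\setminus\{s\}}\big)-\sum_{(s,\ell)\in\underline D_n^2}q_{\lambda_n}(|\theta(s,\ell)|).$$ For $a_n>0$ let $\mathcal M^{(n)}(a_n)$ be the set of $\theta\in\mathcal M^{(n)}$ with at most $a_n$ nonzero entries $\theta(s,\ell)$, $(s,\ell)\in\underline D_n^2$. Let $\Delta_n^{(c)}=\{s\in D_n:\partial s\setminus D_n\neq\emptyset\}$, $$\mathsf n_n=\sup_{\theta\in\mathcal M^{(n)}(a_n)}\ \sup_{s\in\Delta_n^{(c)}}\big|\{\ell\in D_n:\theta(s,\ell)\ne0\}\big|\quad(\sup\emptyset=0),\qquad b_n=\Big\{\sum_{s\in D_n}\Big(\sum_{\ell\in\partial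 s\setminus D_n}|\theta_\star(s,\ell)|\Big)^2\Big\}^{1/2}.$$ **Assumption.** There are $\alpha_n,\alpha_n'>0$ such that, for all $n$ large enough, $$\sum_{s\in D_n}\mathbb E_\star\Big[\mathrm{Var}_{\theta'}\Big(\sum_{\ell\in D_n}\theta(s,\ell)B(X_s,X_\ell)\,\Big|\,X_{D_n\setminus\{s\}}\Big)\Big]\ \ge\ \alpha_n\|\theta\|_2^2\qquad\text{for all }\theta\in\mathcal M^{(n)},\ \theta'\in\mathcal M^{(n)}_K,$$ $$\mathbb E_\star^{1/2}\Big[\Big(\sum_{s\in D_n}\log\frac{f^{(s)}_{\theta_\star^{(n)}+\theta}(X_s\mid X_{D_n\setminus\{s\}})}{f^{(s)}_{\theta_\star^{(n)}}(X_s\mid X_{D_n\setminus\{s\}})}\Big)^2\Big]\ \le\ \alpha_n'\|\theta\|_2\qquad\text{for all }\theta\in\mathcal M^{(n)}\text{ with }\theta_\star^{(n)}+\theta\in\mathcal M^{(n)}_K.$$ **Conclusion.** Suppose that, as $n\to\infty$, $a_n\sqrt{\log p_n}=O(\alpha_n'n^{1/2})$ and $\lambda_n=O(\sqrt{n\log p_n})$,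 and that almost surely $\hat\theta_n-\theta_\star^{(n)}\in\mathcal M^{(n)}(a_n)$ for all $n$ large enough. Then $$r_n\|\hat\theta_n-\theta_\star^{(n)}\|_2=O_p(1),\qquad r_n=\frac{\alpha_n\sqrt n}{\sqrt{a_n\log p_n}+\sqrt n\,b_n\,\mathsf n_n^{1/2}}.$$ -/

import Mathlib

open MeasureTheory Filter Asymptotics

noncomputable section

namespace AutoModel

variable {X S : Type*} [MeasurableSpace X] [LinearOrder S]

/-- The space of infinite symmetric matrices with finite degree at every node. -/
def matrixSpace (S : Type*) : Set (S → S → ℝ) :=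
  {θ | (∀ s ℓ, θ s ℓ = θ ℓ s) ∧ ∀ s, Summable fun ℓ : {ℓ // ℓ ≠ s} => |θ s ℓ|}

/-- The neighborhood of the node `s` in the network `θ`. -/
def nbhd (θ : S → S → ℝ) (s : S) : Set S := {ℓ | ℓ ≠ s ∧ 0 < |θ s ℓ|}

/-- Unnormalized full conditional density of the state `u` at `s` given the states at all the
other nodes. -/
def fullWeight (A B₀ : X → ℝ) (B : X → X → ℝ) (θ : S → S → ℝ) (s : S) (x : S → X) (u : X) : ℝ :=
  Real.exp (A u + θ s s * B₀ u + ∑' ℓ : {ℓ // ℓ ≠ s}, θ s ℓ * B u (x ℓ))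

/-- Full conditional density (with respect to `ρ`) at the node `s`. -/
def fullCond (ρ : Measure X) (A B₀ : X → ℝ) (B : X → X → ℝ) (θ : S → S → ℝ) (s : S)
    (x : S → X) (u : X) : ℝ :=
  fullWeight A B₀ B θ s x u / ∫ v, fullWeight A B₀ B θ s x v ∂ρ

/-- `μ` is the law of an infinite-volume auto-model with network `θ`: a probability measure on
the configurations such that, for every node `s`, the conditional law of the state at `s` given
the sigma-algebra generated by all the other states has the density `fullCond`. -/
def IsAutoModel (ρ : Measure X) (A B₀ : X → ℝ) (B : X → X → ℝ) (θ : S → S → ℝ)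
    (μ : Measure (S → X)) : Prop :=
  IsProbabilityMeasure μ ∧
    ∀ (s : S) (E : Set X), MeasurableSet E →
      μ[Set.indicator ((fun x : S → X => x s) ⁻¹' E) (fun _ => (1 : ℝ)) |
          MeasurableSpace.comap (fun (x : S → X) (ℓ : {ℓ // ℓ ≠ s}) => x ℓ) inferInstance]
        =ᵐ[μ] fun x => ∫ u in E, fullCond ρ A B₀ B θ s x u ∂ρ

/-- Unnormalized approximate full conditional density: only the nodes of `D` are used. -/
def approxWeight (A B₀ : X → ℝ) (B : X → X → ℝ) (D : Finset S) (θ : S → S → ℝ) (s : S)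
    (x : S → X) (u : X) : ℝ :=
  Real.exp (A u + θ s s * B₀ u + ∑ ℓ ∈ D.erase s, θ s ℓ * B u (x ℓ))

/-- Approximate full conditional density `f_θ^{(s)}(u | x_{D \ {s}})`. -/
def approxCond (ρ : Measure X) (A B₀ : X → ℝ) (B : X → X → ℝ) (D : Finset S) (θ : S → S → ℝ)
    (s : S) (x : S → X) (u : X) : ℝ :=
  approxWeight A B₀ B D θ s x u / ∫ v, approxWeight A B₀ B D θ s x v ∂ρ

/-- The approximate conditional law of the state at `s`. -/
def approxLaw (ρ : Measure X) (A B₀ : X → ℝ) (B : X → X → ℝ) (D : Finset S) (θ : S → S → ℝ)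
    (s : S) (x : S → X) : Measure X :=
  ρ.withDensity fun u => ENNReal.ofReal (approxCond ρ A B₀ B D θ s x u)

/-- The conditional variance
`Var_{θ'} (∑_{ℓ ∈ D} θ(s,ℓ) B(X_s, X_ℓ) | X_{D \ {s}})` at the configuration `x`: the state at
`s` is drawn from the approximate conditional law with network `θ'`, the others are those of
`x`. -/
def condVariance (ρ : Measure X) (A B₀ : X → ℝ) (B : X → X → ℝ) (D : Finset S)
    (θ' θ : S → S → ℝ) (s : S) (x : S → X) : ℝ :=
  ProbabilityTheory.variance
    (fun u => ∑ ℓ ∈ D, θ s ℓ * B u (Function.update x s u ℓ))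
    (approxLaw ρ A B₀ B D θ' s x)

/-- Symmetric matrices indexed by `D`, extended by zero outside `D × D`. -/
def finMatrix (D : Finset S) : Set (S → S → ℝ) :=
  {θ | (∀ s ℓ, θ s ℓ = θ ℓ s) ∧ ∀ s ℓ, ¬ (s ∈ D ∧ ℓ ∈ D) → θ s ℓ = 0}

/-- The elements of `finMatrix D` whose absolute row sums are at most `K`. For `K = ⊤` this is
no restriction. -/
def boundedMatrix (D : Finset S) (K : ENNReal) : Set (S → S → ℝ) :=
  {θ | θ ∈ finMatrix D ∧ ∀ s ∈ D, ENNReal.ofReal (∑ ℓ ∈ D, |θ s ℓ|) ≤ K}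

theorem boundedMatrix_top (D : Finset S) : boundedMatrix D ⊤ = finMatrix D := by
  ext θ; simp [boundedMatrix]

/-- The restriction of an infinite matrix to `D × D`. -/
def trunc (D : Finset S) (θ : S → S → ℝ) : S → S → ℝ :=
  fun s ℓ => if s ∈ D ∧ ℓ ∈ D then θ s ℓ else 0

/-- The pairs `(s, ℓ) ∈ D × D` with `s ≤ ℓ`. -/
def pairs (D : Finset S) : Finset (S × S) := (D ×ˢ D).filter fun p => p.1 ≤ p.2

/-- The `ℓ²` norm of a matrix indexed by `D` (each unordered pair is counted once). -/
def norm2 (D : Finset S) (θ : S → S → ℝ) : ℝ := Real.sqrt (∑ p ∈ pairs D, |θ p.1 p.2| ^ 2)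

/-- Matrices in `finMatrix D` with at most `a` nonzero entries among the pairs. -/
def sparse (D : Finset S) (a : ℝ) : Set (S → S → ℝ) :=
  {θ | θ ∈ finMatrix D ∧ (((pairs D).filter fun p => 0 < |θ p.1 p.2|).card : ℝ) ≤ a}

/-- The observed nodes that have a neighbor outside `D`. -/
def boundary (D : Finset S) (θ : S → S → ℝ) : Set S :=
  {s | s ∈ D ∧ (nbhd θ s \ (D : Set S)).Nonempty}

/-- The largest number of nonzero entries in a boundary row of an `a`-sparse matrix (zero if the
boundary is empty). -/
def maxBoundaryDegree (D : Finset S) (θ : S → S → ℝ) (a : ℝ) : ℕ :=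
  sSup {k | ∃ ϑ ∈ sparse D a, ∃ s ∈ boundary D θ, k = (D.filter fun ℓ => 0 < |ϑ s ℓ|).card}

/-- The strength of the dependence between the missing and the observed nodes. -/
def missingStrength (D : Finset S) (θ : S → S → ℝ) : ℝ :=
  Real.sqrt (∑ s ∈ D, (∑' ℓ : (nbhd θ s \ (D : Set S) : Set S), |θ s ℓ|) ^ 2)

/-- The penalized pseudo-log-likelihood of `θ` for the `n` observations `x 0, …, x (n - 1)`. -/
def objective (ρ : Measure X) (A B₀ : X → ℝ) (B : X → X → ℝ) (D : Finset S) (q : ℝ → ℝ) (n : ℕ)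
    (x : ℕ → S → X) (θ : S → S → ℝ) : ℝ :=
  (∑ i ∈ Finset.range n, ∑ s ∈ D, Real.log (approxCond ρ A B₀ B D θ s (x i) (x i s)))
    - ∑ p ∈ pairs D, q |θ p.1 p.2|

/-- The maximizers of `Q` over the parameter set `Θ`. -/
def argmaxSet (Θ : Set (S → S → ℝ)) (Q : (S → S → ℝ) → ℝ) : Set (S → S → ℝ) :=
  {θ | θ ∈ Θ ∧ IsMaxOn Q Θ θ}

/-- The condition on the penalty functions `q lam : [0, ∞) → [0, ∞)`, `lam ≥ 0`. -/
def IsPenalty (q : ℝ → ℝ → ℝ) : Prop :=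
  (∀ lam, 0 ≤ lam →
    (∀ x, 0 ≤ x → 0 ≤ q lam x) ∧ q lam 0 = 0 ∧
      ContinuousWithinAt (q lam) (Set.Ici 0) 0 ∧ ∀ x, 0 < x → DifferentiableAt ℝ (q lam) x) ∧
  ∃ c : ℝ, ∀ lam, 0 < lam → ∀ x, 0 < x → |deriv (q lam) x| / lam ≤ c

/-- The curvature and moment conditions with constants `α`, `α'` on the domain `D`, over the
parameter set `boundedMatrix D K`. -/
def CurvatureMoment (ρ : Measure X) (A B₀ : X → ℝ) (B : X → X → ℝ) (μ : Measure (S → X))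
    (θs : S → S → ℝ) (D : Finset S) (K : ENNReal) (α α' : ℝ) : Prop :=
  (∀ θ ∈ finMatrix D, ∀ θ' ∈ boundedMatrix D K,
    α * norm2 D θ ^ 2 ≤ ∑ s ∈ D, ∫ x, condVariance ρ A B₀ B D θ' θ s x ∂μ) ∧
  (∀ θ ∈ finMatrix D, trunc D θs + θ ∈ boundedMatrix D K →
    Real.sqrt (∫ x, (∑ s ∈ D, Real.log (approxCond ρ A B₀ B D (trunc D θs + θ) s x (x s) /
      approxCond ρ A B₀ B D (trunc D θs) s x (x s))) ^ 2 ∂μ) ≤ α' * norm2 D θ)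

/-- The rate `α √n / (√(a log p) + √n b 𝗇^{1/2})`. -/
def rate (D : Finset S) (θs : S → S → ℝ) (n : ℕ) (α a : ℝ) : ℝ :=
  α * Real.sqrt n / (Real.sqrt (a * Real.log D.card) +
    Real.sqrt n * missingStrength D θs * Real.sqrt (maxBoundaryDegree D θs a))

/-- `Y n = O_p(1)` as `n → ∞`. -/
def IsBoundedInProb {Ω : Type*} [MeasurableSpace Ω] (P : Measure Ω) (Y : ℕ → Ω → ℝ) : Prop :=
  ∀ ε : ℝ, 0 < ε → ∃ M : ℝ, ∀ᶠ n in atTop, P {ω | M < |Y n ω|} ≤ ENNReal.ofReal ε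

end AutoModel

end

/-! Each approximate conditional density is an exponential family in its row of the network, so
everything can be expanded at the truncated truth. Write `δ` for the error of the estimator. The
gain in log-density at `s` is a linear term in `δ`, with the score as coefficient, minus the
log-Laplace transform of a centred bounded perturbation. That transform is at least a constant times
the conditional variance at the truth (`integral_add_curvConst_mul_variance_le`,
`log_approxCond_add_sub_le`). The constant depends only on a bound for the perturbation, hence on
`K` and the bound on `B`.

The objective at the maximizer is at least its value at the truth, so `basic_inequality` bounds the
empirical quadratic form in `δ` by a linear form plus a Lipschitz penalty term. All random sums sit
at the truth, with `δ` only as a coefficient. Hoeffding and a union bound over the scores and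
covariance entries therefore suffice (`measure_not_isConcentrated_le`), and no uniformity over
networks is needed.

The mean score need not vanish, because the likelihood ignores nodes outside `D`. The true
conditional law is a tilt of the approximate one by the outside interactions, so the bias is of the
order of their strength (`IsAutoModel.abs_integral_score_le`). It occurs only in boundary rows,
which brings in `missingStrength` and `maxBoundaryDegree`. Sparsity turns `ℓ¹` norms of `δ` into
`ℓ²` norms; curvature bounds the mean quadratic form below; dividing by the norm gives the rate
(`rate_mul_norm2_le`).

This requires `K` finite. For `K = ⊤` the curvature condition contradicts itself: a variance bounded
below along an unbounded exponential family would push the mean of a bounded function to infinity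
(`not_forall_le_variance_tilted`). -/

namespace AutoModel

open ProbabilityTheory

/-! ### Exponential tilts of bounded functions. -/

section Tilting

variable {X : Type*} [MeasurableSpace X]

theorem integrable_of_abs_le {ν : Measure X} [IsFiniteMeasure ν] {f : X → ℝ} (hf : Measurable f)
    {C : ℝ} (hC : ∀ u, |f u| ≤ C) : Integrable f ν :=
  Integrable.of_bound hf.aestronglyMeasurable C (ae_of_all _ fun u => by simpa using hC u)

theorem abs_integral_le_of_abs_le {ν : Measure X} [IsProbabilityMeasure ν] {f : X → ℝ} {C : ℝ}
    (hC : ∀ u, |f u| ≤ C) : |∫ u, f u ∂ν| ≤ C := by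
  have h := norm_integral_le_of_norm_le_const (μ := ν) (f := f) (C := C)
    (ae_of_all _ fun u => by simpa using hC u)
  simpa using h

theorem integrable_exp_of_abs_le {ν : Measure X} [IsFiniteMeasure ν] {f : X → ℝ}
    (hf : Measurable f) {C : ℝ} (hC : ∀ u, |f u| ≤ C) :
    Integrable (fun u => Real.exp (f u)) ν :=
  integrable_of_abs_le (Real.measurable_exp.comp hf) (C := Real.exp C) fun u => by
    rw [abs_of_pos (Real.exp_pos _)]
    exact Real.exp_le_exp.2 ((le_abs_self _).trans (hC u))

/-- On `[-M, ∞)` the second derivative of `exp` is at least `exp (-M)`. Concretely, the difference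
of the two sides vanishes at `0` and its derivative has the sign of the variable there. -/
theorem one_add_add_sq_le_exp {M x : ℝ} (hx : |x| ≤ M) :
    1 + x + Real.exp (-M) / 2 * x ^ 2 ≤ Real.exp x := by
  have hd : ∀ y : ℝ, HasDerivAt (fun y => Real.exp y - 1 - y - Real.exp (-M) / 2 * y ^ 2)
      (Real.exp y - 1 - Real.exp (-M) * y) y := fun y => by
    have h := (((Real.hasDerivAt_exp y).sub_const 1).sub (hasDerivAt_id y)).sub
      ((hasDerivAt_pow 2 y).const_mul (Real.exp (-M) / 2))
    exact h.congr_deriv (by simp; ring)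
  have hM : 0 ≤ M := (abs_nonneg x).trans hx
  have hc : Real.exp (-M) ≤ 1 := Real.exp_le_one_iff.2 (by linarith)
  have hc0 := Real.exp_pos (-M)
  have hcont : Continuous (fun y => Real.exp y - 1 - y - Real.exp (-M) / 2 * y ^ 2) := by fun_prop
  rcases le_total 0 x with h0 | h0
  · have hmono : MonotoneOn (fun y => Real.exp y - 1 - y - Real.exp (-M) / 2 * y ^ 2)
        (Set.Ici 0) := by
      refine monotoneOn_of_deriv_nonneg (convex_Ici 0) hcont.continuousOn
        (fun y _ => (hd y).differentiableAt.differentiableWithinAt) fun y hy => ?_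
      rw [interior_Ici] at hy
      rw [(hd y).deriv]
      have := Real.add_one_le_exp y
      have hy' : (0 : ℝ) < y := hy
      nlinarith
    have := hmono (Set.mem_Ici.2 le_rfl) (Set.mem_Ici.2 h0) h0
    simp at this
    linarith
  · have hanti : AntitoneOn (fun y => Real.exp y - 1 - y - Real.exp (-M) / 2 * y ^ 2)
        (Set.Icc (-M) 0) := by
      refine antitoneOn_of_deriv_nonpos (convex_Icc _ _) hcont.continuousOn
        (fun y _ => (hd y).differentiableAt.differentiableWithinAt) fun y hy => ?_
      rw [interior_Icc] at hy
      rw [(hd y).deriv]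
      have h1 := Real.add_one_le_exp (-y)
      have h2 : Real.exp y * Real.exp (-y) = 1 := by rw [← Real.exp_add]; simp
      have h3 : Real.exp (-M) ≤ Real.exp y := Real.exp_le_exp.2 hy.1.le
      have h4 := Real.exp_pos y
      nlinarith [hy.2]
    have hxM : -M ≤ x := by linarith [neg_abs_le x]
    have := hanti ⟨hxM, h0⟩ ⟨by linarith, le_rfl⟩ h0
    simp at this
    linarith

/-- The constant in the quadratic lower bound for the log-Laplace transform of a function bounded
by `M`. -/
noncomputable def curvConst (M : ℝ) : ℝ :=
  Real.exp (-(2 * M)) / 2 / (1 + Real.exp (-(2 * M)) / 2 * (2 * M) ^ 2)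

theorem curvConst_pos (M : ℝ) : 0 < curvConst M := by unfold curvConst; positivity

/-- After centring, `h - m` is bounded by `2 * M`, and integrating the quadratic minorant of `exp`
gives `1 + c V`. Then `log (1 + t) ≥ t / (1 + t)` together with `V ≤ (2 * M) ^ 2` makes the bound
linear in `V`. -/
theorem integral_add_curvConst_mul_variance_le {ν : Measure X} [IsProbabilityMeasure ν]
    {h : X → ℝ} (hh : Measurable h) {M : ℝ} (hM : ∀ u, |h u| ≤ M) :
    (∫ u, h u ∂ν) + curvConst M * variance h ν ≤ Real.log (∫ u, Real.exp (h u) ∂ν) := by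
  set m := ∫ u, h u ∂ν with hm
  set c := Real.exp (-(2 * M)) / 2 with hc
  have hc0 : 0 < c := by positivity
  have hmM : |m| ≤ M := abs_integral_le_of_abs_le hM
  have hcen : ∀ u, |h u - m| ≤ 2 * M := fun u => by
    have := abs_sub (h u) m
    linarith [hM u]
  have hV : variance h ν = ∫ u, (h u - m) ^ 2 ∂ν := variance_eq_integral hh.aemeasurable
  have hsq : ∀ u, |(h u - m) ^ 2| ≤ (2 * M) ^ 2 := fun u => by
    rw [abs_pow]; exact pow_le_pow_left₀ (abs_nonneg _) (hcen u) 2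
  have hV0 : 0 ≤ variance h ν := variance_nonneg _ _
  have hVle : variance h ν ≤ (2 * M) ^ 2 := by
    rw [hV]; exact (le_abs_self _).trans (abs_integral_le_of_abs_le hsq)
  have hi1 : Integrable (fun u => h u - m) ν := integrable_of_abs_le (hh.sub_const m) hcen
  have hi2 : Integrable (fun u => (h u - m) ^ 2) ν :=
    integrable_of_abs_le ((hh.sub_const m).pow_const 2) hsq
  have hint : 1 + c * variance h ν ≤ ∫ u, Real.exp (h u - m) ∂ν := by
    have h1 : ∫ u, (1 + (h u - m) + c * (h u - m) ^ 2) ∂ν = 1 + c * variance h ν := by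
      rw [integral_add (by fun_prop) (by fun_prop), integral_add (by fun_prop) hi1,
        integral_const_mul, ← hV, integral_sub (integrable_of_abs_le hh hM) (by fun_prop)]
      simp [← hm]
    rw [← h1]
    refine integral_mono (by fun_prop) (integrable_exp_of_abs_le (hh.sub_const m) hcen) fun u => ?_
    exact one_add_add_sq_le_exp (hcen u)
  have hexp : ∫ u, Real.exp (h u) ∂ν = Real.exp m * ∫ u, Real.exp (h u - m) ∂ν := by
    rw [← integral_const_mul]
    congr 1; ext u
    rw [← Real.exp_add]; congr 1; ring
  have hpos : 0 < 1 + c * variance h ν := by positivity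
  rw [hexp, Real.log_mul (Real.exp_pos _).ne' (hpos.trans_le hint).ne', Real.log_exp]
  have h2 : curvConst M * variance h ν ≤ Real.log (1 + c * variance h ν) := by
    have h3 := Real.one_sub_inv_le_log_of_pos hpos
    refine le_trans ?_ h3
    have h4 : 1 - (1 + c * variance h ν)⁻¹ = c * variance h ν / (1 + c * variance h ν) := by
      field_simp; ring
    rw [h4, curvConst, ← hc, div_mul_eq_mul_div]
    gcongr
  have h5 := Real.log_le_log hpos hint
  linarith

/-- Numerator and normalizer both lie in `[exp (-b), exp b]`, so the density lies in `[exp (-2b),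
exp (2b)]`; the upper deviation dominates because `exp t + exp (-t) ≥ 2`. -/
theorem abs_exp_div_sub_one_le {ν : Measure X} [IsProbabilityMeasure ν] {r : X → ℝ}
    (hr : Measurable r) {b : ℝ} (hb : ∀ u, |r u| ≤ b) (u : X) :
    |Real.exp (r u) / (∫ v, Real.exp (r v) ∂ν) - 1| ≤ Real.exp (2 * b) - 1 := by
  have hi := integrable_exp_of_abs_le (ν := ν) hr hb
  have hb0 : 0 ≤ b := (abs_nonneg _).trans (hb u)
  have hlo : Real.exp (-b) ≤ ∫ v, Real.exp (r v) ∂ν := by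
    have := integral_mono (μ := ν) (integrable_const (Real.exp (-b))) hi
      fun v => Real.exp_le_exp.2 (abs_le.1 (hb v)).1
    simpa using this
  have hhi : ∫ v, Real.exp (r v) ∂ν ≤ Real.exp b := by
    have := integral_mono (μ := ν) hi (integrable_const (Real.exp b))
      fun v => Real.exp_le_exp.2 (abs_le.1 (hb v)).2
    simpa using this
  have hZ : 0 < ∫ v, Real.exp (r v) ∂ν := (Real.exp_pos _).trans_le hlo
  have h1 : Real.exp (r u) / (∫ v, Real.exp (r v) ∂ν) ≤ Real.exp (2 * b) := by
    rw [div_le_iff₀ hZ]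
    calc Real.exp (r u) ≤ Real.exp b := Real.exp_le_exp.2 (abs_le.1 (hb u)).2
      _ = Real.exp (2 * b) * Real.exp (-b) := by rw [← Real.exp_add]; congr 1; ring
      _ ≤ _ := by gcongr
  have h2 : Real.exp (-(2 * b)) ≤ Real.exp (r u) / (∫ v, Real.exp (r v) ∂ν) := by
    rw [le_div_iff₀ hZ]
    calc _ ≤ Real.exp (-(2 * b)) * Real.exp b := by gcongr
      _ = Real.exp (-b) := by rw [← Real.exp_add]; congr 1; ring
      _ ≤ _ := Real.exp_le_exp.2 (abs_le.1 (hb u)).1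
  have h3 : 2 ≤ Real.exp (2 * b) + Real.exp (-(2 * b)) := by
    have := Real.add_one_le_exp (2 * b)
    have := Real.add_one_le_exp (-(2 * b))
    linarith
  rw [abs_le]; constructor <;> linarith

/-- Tilting by a function bounded by `b` changes the integral of a function bounded by `G` by at
most `4 b G`. -/
theorem abs_integral_tilted_sub_le {ν : Measure X} [IsProbabilityMeasure ν] {r g : X → ℝ}
    (hr : Measurable r) {b : ℝ} (hb0 : 0 ≤ b) (hb : ∀ u, |r u| ≤ b) (hg : Measurable g) {G : ℝ}
    (hG : ∀ u, |g u| ≤ G) :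
    |(∫ u, g u ∂(ν.tilted r)) - ∫ u, g u ∂ν| ≤ 4 * b * G := by
  have : Nonempty X := nonempty_of_isProbabilityMeasure ν
  have hG0 : 0 ≤ G := (abs_nonneg _).trans (hG (Classical.arbitrary X))
  have hprob : IsProbabilityMeasure (ν.tilted r) :=
    isProbabilityMeasure_tilted (integrable_exp_of_abs_le hr hb)
  -- For `2 * b ≤ 1` the density deviation is at most `2 * (2 * b)`; otherwise the trivial bound `2
  -- * G` is already below `4 * b * G`.
  rcases le_total (2 * b) 1 with h | h
  · have hd : Measurable fun u => Real.exp (r u) / (∫ v, Real.exp (r v) ∂ν) - 1 :=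
      ((Real.measurable_exp.comp hr).div_const _).sub_const _
    have hbd : ∀ u, |(Real.exp (r u) / (∫ v, Real.exp (r v) ∂ν) - 1) * g u| ≤
        (Real.exp (2 * b) - 1) * G := fun u => by
      rw [abs_mul]
      exact mul_le_mul (abs_exp_div_sub_one_le hr hb u) (hG u) (abs_nonneg _)
        ((abs_nonneg _).trans (abs_exp_div_sub_one_le (ν := ν) hr hb u))
    have heq : (∫ u, g u ∂(ν.tilted r)) - ∫ u, g u ∂ν =
        ∫ u, (Real.exp (r u) / (∫ v, Real.exp (r v) ∂ν) - 1) * g u ∂ν := by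
      have hi : Integrable (fun u => (Real.exp (r u) / (∫ v, Real.exp (r v) ∂ν) - 1) * g u) ν :=
        integrable_of_abs_le (hd.mul hg) hbd
      rw [integral_tilted, sub_eq_iff_eq_add, ← integral_add hi (integrable_of_abs_le hg hG)]
      congr 1; ext u; simp only [smul_eq_mul]; ring
    rw [heq]
    refine (abs_integral_le_of_abs_le hbd).trans ?_
    have := Real.abs_exp_sub_one_le (x := 2 * b) (by rw [abs_of_nonneg (by linarith)]; exact h)
    rw [abs_of_nonneg (by linarith : (0:ℝ) ≤ 2 * b)] at this
    have := (le_abs_self _).trans this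
    nlinarith
  · have h1 := abs_integral_le_of_abs_le (ν := ν.tilted r) hG
    have h2 := abs_integral_le_of_abs_le (ν := ν) hG
    have := abs_sub (∫ u, g u ∂(ν.tilted r)) (∫ u, g u ∂ν)
    nlinarith

/-- Apply the log-Laplace bound to `h` under `ν` and to `-h` under the tilt. The two Laplace
transforms are reciprocal, so their logarithms cancel on adding. -/
theorem integral_add_curvConst_le_integral_tilted {ν : Measure X} [IsProbabilityMeasure ν]
    {h : X → ℝ} (hh : Measurable h) {M α : ℝ} (hM : ∀ u, |h u| ≤ M) (h0 : α ≤ variance h ν)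
    (h1 : α ≤ variance h (ν.tilted h)) :
    (∫ u, h u ∂ν) + 2 * curvConst M * α ≤ ∫ u, h u ∂(ν.tilted h) := by
  have hi := integrable_exp_of_abs_le (ν := ν) hh hM
  have : IsProbabilityMeasure (ν.tilted h) := isProbabilityMeasure_tilted hi
  have e0 := integral_add_curvConst_mul_variance_le (ν := ν) hh hM
  have e1 := integral_add_curvConst_mul_variance_le (ν := ν.tilted h) (h := -h) hh.neg (M := M)
    (by simpa using hM)
  rw [variance_neg, integral_exp_tilted] at e1
  simp only [Pi.neg_apply, integral_neg, Pi.add_apply, add_neg_cancel, Real.exp_zero] at e1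
  simp only [integral_const, probReal_univ, smul_eq_mul, mul_one, one_div, Real.log_inv] at e1
  have hc := curvConst_pos M
  nlinarith

/-- Along an unbounded exponential family generated by a bounded function, the variance of that
function is not bounded away from zero. -/
theorem not_forall_le_variance_tilted {ρ : Measure X} [IsFiniteMeasure ρ] [NeZero ρ]
    {f h : X → ℝ} (hf : Measurable f) (hh : Measurable h) {C M : ℝ} (hC : ∀ u, |f u| ≤ C)
    (hM : ∀ u, |h u| ≤ M) {α : ℝ} (hα : 0 < α) :
    ¬ ∀ k : ℕ, α ≤ variance h (ρ.tilted fun u => f u + k * h u) := by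
  intro H
  have hmeas : ∀ k : ℕ, Measurable fun u => f u + k * h u := fun k => hf.add (hh.const_mul _)
  have hbd : ∀ (k : ℕ) (u : X), |f u + k * h u| ≤ C + k * M := fun k u => by
    refine (abs_add_le _ _).trans (add_le_add (hC u) ?_)
    rw [abs_mul, Nat.abs_cast]
    exact mul_le_mul_of_nonneg_left (hM u) (Nat.cast_nonneg k)
  have hi := fun k : ℕ => integrable_exp_of_abs_le (ν := ρ) (hmeas k) (hbd k)
  have hp := fun k : ℕ => isProbabilityMeasure_tilted (hi k)
  have hc := curvConst_pos M
  -- Each unit tilt raises the mean of `h` by a fixed positive amount, while that mean must stay in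
  -- `[-M, M]`.
  have hgrow : ∀ k : ℕ, (∫ u, h u ∂(ρ.tilted fun u => f u + (0 : ℕ) * h u))
      + k * (2 * curvConst M * α) ≤ ∫ u, h u ∂(ρ.tilted fun u => f u + k * h u) := by
    intro k
    induction k with
    | zero => simp
    | succ k ih =>
      have hs : (ρ.tilted fun u => f u + k * h u).tilted h =
          ρ.tilted fun u => f u + (k + 1 : ℕ) * h u := by
        rw [tilted_tilted (hi k)]
        congr 1; ext u; simp only [Pi.add_apply]; push_cast; ring
      have h1 := integral_add_curvConst_le_integral_tilted hh hM (H k) (hs ▸ H (k + 1))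
      rw [hs] at h1
      push_cast at h1 ih ⊢
      linarith
  obtain ⟨k, hk⟩ := exists_nat_gt (2 * M / (2 * curvConst M * α))
  rw [div_lt_iff₀ (by positivity)] at hk
  have h0 := abs_le.1 (abs_integral_le_of_abs_le (ν := ρ.tilted fun u => f u + (0 : ℕ) * h u) hM)
  have h1 := abs_le.1 (abs_integral_le_of_abs_le (ν := ρ.tilted fun u => f u + k * h u) hM)
  linarith [hgrow k]

end Tilting

/-! ### Hoeffding's inequality for the sample sums. -/

section Concentration

variable {Ω : Type*} [MeasurableSpace Ω]

/-- Two-sided Hoeffding inequality for bounded, identically distributed variables. -/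
theorem measure_abs_sum_sub_ge_le {E : Type*} [MeasurableSpace E] {P : Measure Ω}
    [IsProbabilityMeasure P] {μ : Measure E} {Y : ℕ → Ω → E} (hY : ∀ i, Measurable (Y i))
    (hlaw : ∀ i, P.map (Y i) = μ) (hind : iIndepFun Y P) {T : E → ℝ} (hT : Measurable T)
    {R : ℝ} (hR : ∀ x, |T x| ≤ R) (n : ℕ) {τ : ℝ} (hτ : 0 ≤ τ) :
    P {ω | τ ≤ |∑ i ∈ Finset.range n, T (Y i ω) - n * ∫ x, T x ∂μ|} ≤
      ENNReal.ofReal (2 * Real.exp (-τ ^ 2 / (2 * n * R ^ 2))) := by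
  have hmean : ∀ i, ∫ ω, T (Y i ω) ∂P = ∫ x, T x ∂μ := fun i => by
    rw [← hlaw i, integral_map (hY i).aemeasurable hT.aestronglyMeasurable]
  have key : ∀ T' : E → ℝ, Measurable T' → (∀ x, |T' x| ≤ R) →
      P.real {ω | τ ≤ ∑ i ∈ Finset.range n, (T' (Y i ω) - ∫ ω, T' (Y i ω) ∂P)} ≤
        Real.exp (-τ ^ 2 / (2 * n * R ^ 2)) := by
    intro T' hT' hR'
    -- The interval `[-R, R]` has half-length `R`, so the variance proxy is `R ^ 2`.
    have hsub : ∀ i < n, HasSubgaussianMGF (fun ω => T' (Y i ω) - ∫ ω, T' (Y i ω) ∂P)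
        ((‖R - (-R)‖₊ / 2) ^ 2) P := fun i _ =>
      hasSubgaussianMGF_of_mem_Icc (hT'.comp (hY i)).aemeasurable
        (ae_of_all _ fun ω => abs_le.1 (hR' _))
    have hind' : iIndepFun (fun i ω => T' (Y i ω) - ∫ ω, T' (Y i ω) ∂P) P :=
      hind.comp (fun i x => T' x - ∫ ω, T' (Y i ω) ∂P) fun i => hT'.sub_const _
    have h := HasSubgaussianMGF.measure_sum_range_ge_le_of_iIndepFun hind' hsub hτ
    convert h using 4
    push_cast
    rw [div_pow, Real.norm_eq_abs, sq_abs]; ring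
  have h1 := key T hT hR
  have h2 := key (fun x => -T x) hT.neg (by simpa using hR)
  have hsub : {ω | τ ≤ |∑ i ∈ Finset.range n, T (Y i ω) - n * ∫ x, T x ∂μ|} ⊆
      {ω | τ ≤ ∑ i ∈ Finset.range n, (T (Y i ω) - ∫ ω, T (Y i ω) ∂P)} ∪
      {ω | τ ≤ ∑ i ∈ Finset.range n, (-T (Y i ω) - ∫ ω, -T (Y i ω) ∂P)} := by
    intro ω hω
    simp only [Set.mem_ofPred_eq, Set.mem_union, integral_neg, hmean, Finset.sum_sub_distrib,
      Finset.sum_neg_distrib, Finset.sum_const, Finset.card_range, nsmul_eq_mul] at hω ⊢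
    rcases le_abs.1 hω with h | h
    · left; linarith
    · right; linarith
  refine (measure_mono hsub).trans ((measure_union_le _ _).trans ?_)
  rw [two_mul, ENNReal.ofReal_add (Real.exp_pos _).le (Real.exp_pos _).le]
  refine add_le_add ?_ ?_
  · rw [← ofReal_measureReal]; exact ENNReal.ofReal_le_ofReal h1
  · rw [← ofReal_measureReal]; exact ENNReal.ofReal_le_ofReal h2

end Concentration

/-! ### Approximate conditional laws as exponential families: scores and covariances. -/

section Model

variable {X S : Type*}

/-- The interaction of the state `u` at `s` with the state at `ℓ`, as a function of `u`. -/
def interaction [DecidableEq S] (B : X → X → ℝ) (s : S) (x : S → X) (ℓ : S) (u : X) : ℝ :=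
  B u (Function.update x s u ℓ)

theorem interaction_of_ne [DecidableEq S] {B : X → X → ℝ} {s ℓ : S} (hne : ℓ ≠ s)
    (x : S → X) (u : X) : interaction B s x ℓ u = B u (x ℓ) := by
  simp [interaction, hne]

theorem interaction_apply [DecidableEq S] {B : X → X → ℝ} (s ℓ : S) (x : S → X) :
    interaction B s x ℓ (x s) = B (x s) (x ℓ) := by
  simp [interaction]

variable [MeasurableSpace X]

/-- The functions defining the auto-model are measurable and bounded by `C`. -/
structure IsRegular (A B₀ : X → ℝ) (B : X → X → ℝ) (C : ℝ) : Prop where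
  measurable_A : Measurable A
  measurable_B₀ : Measurable B₀
  measurable_B : Measurable (Function.uncurry B)
  diag : ∀ x, B x x = B₀ x
  nonneg : 0 ≤ C
  abs_A : ∀ x, |A x| ≤ C
  abs_B₀ : ∀ x, |B₀ x| ≤ C
  abs_B : ∀ x y, |B x y| ≤ C

variable {A B₀ : X → ℝ} {B : X → X → ℝ} {C : ℝ} {ρ : Measure X} {μ : Measure (S → X)}

/-- The update puts `u` in both arguments of `B`, so the diagonal parameter becomes one more
coefficient of a single linear form over `D`. -/
theorem interaction_self [DecidableEq S] (h : IsRegular A B₀ B C) (s : S) (x : S → X) (u : X) :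
    interaction B s x s u = B₀ u := by
  simp [interaction, h.diag]

theorem abs_interaction_le [DecidableEq S] (h : IsRegular A B₀ B C) (s : S) (x : S → X) (ℓ : S)
    (u : X) : |interaction B s x ℓ u| ≤ C := h.abs_B _ _

theorem measurable_apply_apply (h : IsRegular A B₀ B C) (s ℓ : S) :
    Measurable fun x : S → X => B (x s) (x ℓ) := by
  have hp : Measurable fun x : S → X => (x s, x ℓ) :=
    (measurable_pi_apply s).prodMk (measurable_pi_apply ℓ)
  exact h.measurable_B.comp hp

theorem measurable_interaction_uncurry [DecidableEq S] (h : IsRegular A B₀ B C) (s ℓ : S) :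
    Measurable fun p : (S → X) × X => interaction B s p.1 ℓ p.2 := by
  by_cases hne : ℓ = s
  · subst hne
    simp_rw [interaction_self h]
    exact h.measurable_B₀.comp measurable_snd
  · simp_rw [interaction_of_ne hne]
    exact h.measurable_B.comp
      (measurable_snd.prodMk ((measurable_pi_apply ℓ).comp measurable_fst))

theorem measurable_interaction [DecidableEq S] (h : IsRegular A B₀ B C) (s : S) (x : S → X)
    (ℓ : S) : Measurable (interaction B s x ℓ) :=
  (measurable_interaction_uncurry h s ℓ).comp measurable_prodMk_left

section Approx

variable [LinearOrder S] {D : Finset S} {s : S}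

/-- The exponent in the approximate full conditional density. -/
def approxExponent (A : X → ℝ) (B : X → X → ℝ) (D : Finset S) (θ : S → S → ℝ) (s : S) (x : S → X)
    (u : X) : ℝ := A u + ∑ ℓ ∈ D, θ s ℓ * interaction B s x ℓ u

theorem approxWeight_eq (h : IsRegular A B₀ B C) (hs : s ∈ D) (θ : S → S → ℝ) (x : S → X)
    (u : X) : approxWeight A B₀ B D θ s x u = Real.exp (approxExponent A B D θ s x u) := by
  rw [approxWeight, approxExponent, ← Finset.add_sum_erase D _ hs, interaction_self h, ← add_assoc]
  congr 2
  exact Finset.sum_congr rfl fun ℓ hℓ => by rw [interaction_of_ne (Finset.ne_of_mem_erase hℓ)]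

theorem measurable_approxExponent_uncurry (h : IsRegular A B₀ B C) (θ : S → S → ℝ) :
    Measurable fun p : (S → X) × X => approxExponent A B D θ s p.1 p.2 :=
  (h.measurable_A.comp measurable_snd).add
    (Finset.measurable_sum _ fun ℓ _ => (measurable_interaction_uncurry h s ℓ).const_mul _)

theorem measurable_approxExponent (h : IsRegular A B₀ B C) (θ : S → S → ℝ) (x : S → X) :
    Measurable (approxExponent A B D θ s x) :=
  (measurable_approxExponent_uncurry h θ).comp measurable_prodMk_left

theorem abs_sum_mul_interaction_le (h : IsRegular A B₀ B C) (D : Finset S) (θ : S → S → ℝ) (s : S)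
    (x : S → X) (u : X) :
    |∑ ℓ ∈ D, θ s ℓ * interaction B s x ℓ u| ≤ (∑ ℓ ∈ D, |θ s ℓ|) * C := by
  rw [Finset.sum_mul]
  refine (Finset.abs_sum_le_sum_abs _ _).trans (Finset.sum_le_sum fun ℓ _ => ?_)
  rw [abs_mul]
  exact mul_le_mul_of_nonneg_left (abs_interaction_le h s x ℓ u) (abs_nonneg _)

theorem abs_approxExponent_le (h : IsRegular A B₀ B C) (θ : S → S → ℝ) (x : S → X) (u : X) :
    |approxExponent A B D θ s x u| ≤ C + (∑ ℓ ∈ D, |θ s ℓ|) * C :=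
  (abs_add_le _ _).trans (add_le_add (h.abs_A u) (abs_sum_mul_interaction_le h D θ s x u))

theorem integrable_exp_approxExponent [IsFiniteMeasure ρ] (h : IsRegular A B₀ B C)
    (θ : S → S → ℝ) (x : S → X) :
    Integrable (fun u => Real.exp (approxExponent A B D θ s x u)) ρ :=
  integrable_exp_of_abs_le (measurable_approxExponent h θ x) (abs_approxExponent_le h θ x)

theorem approxCond_eq (h : IsRegular A B₀ B C) (hs : s ∈ D) (θ : S → S → ℝ) (x : S → X) (u : X) :
    approxCond ρ A B₀ B D θ s x u = Real.exp (approxExponent A B D θ s x u) /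
      ∫ v, Real.exp (approxExponent A B D θ s x v) ∂ρ := by
  simp_rw [approxCond, approxWeight_eq h hs]

theorem approxLaw_eq_tilted (h : IsRegular A B₀ B C) (hs : s ∈ D) (θ : S → S → ℝ) (x : S → X) :
    approxLaw ρ A B₀ B D θ s x = ρ.tilted (approxExponent A B D θ s x) := by
  simp_rw [approxLaw, Measure.tilted, approxCond_eq h hs]

theorem isProbabilityMeasure_approxLaw [IsFiniteMeasure ρ] [NeZero ρ] (h : IsRegular A B₀ B C)
    (hs : s ∈ D) (θ : S → S → ℝ) (x : S → X) :
    IsProbabilityMeasure (approxLaw ρ A B₀ B D θ s x) := by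
  rw [approxLaw_eq_tilted h hs]
  exact isProbabilityMeasure_tilted (integrable_exp_approxExponent h θ x)

theorem measurable_integral_approxLaw [IsFiniteMeasure ρ] (h : IsRegular A B₀ B C) (hs : s ∈ D)
    (θ : S → S → ℝ) {g : (S → X) → X → ℝ} (hg : Measurable fun p : (S → X) × X => g p.1 p.2) :
    Measurable fun x => ∫ u, g x u ∂(approxLaw ρ A B₀ B D θ s x) := by
  simp_rw [approxLaw_eq_tilted h hs, integral_tilted]
  have hE : Measurable fun p : (S → X) × X => Real.exp (approxExponent A B D θ s p.1 p.2) :=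
    Real.measurable_exp.comp (measurable_approxExponent_uncurry h θ)
  have hZ : Measurable fun x => ∫ v, Real.exp (approxExponent A B D θ s x v) ∂ρ :=
    (hE.stronglyMeasurable.integral_prod_right (ν := ρ)).measurable
  have hI : Measurable fun p : (S → X) × X =>
      (Real.exp (approxExponent A B D θ s p.1 p.2) /
        ∫ v, Real.exp (approxExponent A B D θ s p.1 v) ∂ρ) • g p.1 p.2 :=
    (hE.div (hZ.comp measurable_fst)).smul hg
  exact (hI.stronglyMeasurable.integral_prod_right (ν := ρ)).measurable

/-- The derivative of the approximate log-conditional density at `s` with respect to the entry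
`(s, ℓ)` of the network. -/
noncomputable def score (ρ : Measure X) (A B₀ : X → ℝ) (B : X → X → ℝ) (D : Finset S)
    (θ : S → S → ℝ) (s ℓ : S) (x : S → X) : ℝ :=
  B (x s) (x ℓ) - ∫ u, interaction B s x ℓ u ∂(approxLaw ρ A B₀ B D θ s x)

/-- The entry `(ℓ, k)` of the conditional covariance matrix of the interactions at `s`. -/
noncomputable def interactionCov (ρ : Measure X) (A B₀ : X → ℝ) (B : X → X → ℝ) (D : Finset S)
    (θ : S → S → ℝ) (s ℓ k : S) (x : S → X) : ℝ :=
  covariance (interaction B s x ℓ) (interaction B s x k) (approxLaw ρ A B₀ B D θ s x)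

section Stat

variable [IsFiniteMeasure ρ] [NeZero ρ]

theorem abs_score_le (h : IsRegular A B₀ B C) (hs : s ∈ D) (θ : S → S → ℝ) (ℓ : S) (x : S → X) :
    |score ρ A B₀ B D θ s ℓ x| ≤ 2 * C := by
  have := isProbabilityMeasure_approxLaw (ρ := ρ) h hs θ x
  have h1 := abs_integral_le_of_abs_le (ν := approxLaw ρ A B₀ B D θ s x)
    (abs_interaction_le h s x ℓ)
  have h2 := h.abs_B (x s) (x ℓ)
  have := abs_sub (B (x s) (x ℓ)) (∫ u, interaction B s x ℓ u ∂(approxLaw ρ A B₀ B D θ s x))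
  rw [score]; linarith

theorem measurable_score (h : IsRegular A B₀ B C) (hs : s ∈ D) (θ : S → S → ℝ) (ℓ : S) :
    Measurable (score ρ A B₀ B D θ s ℓ) := by
  exact (measurable_apply_apply h s ℓ).sub (measurable_integral_approxLaw h hs θ (g := fun x => interaction B s x ℓ)
    (measurable_interaction_uncurry h s ℓ))

theorem memLp_interaction (h : IsRegular A B₀ B C) (hs : s ∈ D) (θ : S → S → ℝ) (x : S → X)
    (ℓ : S) : MemLp (interaction B s x ℓ) 2 (approxLaw ρ A B₀ B D θ s x) := by
  have := isProbabilityMeasure_approxLaw (ρ := ρ) h hs θ x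
  exact MemLp.of_bound (measurable_interaction h s x ℓ).aestronglyMeasurable C
    (ae_of_all _ fun u => abs_interaction_le h s x ℓ u)

theorem interactionCov_eq (h : IsRegular A B₀ B C) (hs : s ∈ D) (θ : S → S → ℝ) (ℓ k : S)
    (x : S → X) : interactionCov ρ A B₀ B D θ s ℓ k x =
      (∫ u, interaction B s x ℓ u * interaction B s x k u ∂(approxLaw ρ A B₀ B D θ s x)) -
      (∫ u, interaction B s x ℓ u ∂(approxLaw ρ A B₀ B D θ s x)) *
        ∫ u, interaction B s x k u ∂(approxLaw ρ A B₀ B D θ s x) := by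
  have := isProbabilityMeasure_approxLaw (ρ := ρ) h hs θ x
  exact covariance_eq_sub (memLp_interaction h hs θ x ℓ) (memLp_interaction h hs θ x k)

theorem abs_interactionCov_le (h : IsRegular A B₀ B C) (hs : s ∈ D) (θ : S → S → ℝ) (ℓ k : S)
    (x : S → X) : |interactionCov ρ A B₀ B D θ s ℓ k x| ≤ 2 * C ^ 2 := by
  have := isProbabilityMeasure_approxLaw (ρ := ρ) h hs θ x
  have h1 := abs_integral_le_of_abs_le (ν := approxLaw ρ A B₀ B D θ s x)
    (abs_interaction_le h s x ℓ)
  have h2 := abs_integral_le_of_abs_le (ν := approxLaw ρ A B₀ B D θ s x)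
    (abs_interaction_le h s x k)
  have h3 := abs_integral_le_of_abs_le (ν := approxLaw ρ A B₀ B D θ s x)
    (f := fun u => interaction B s x ℓ u * interaction B s x k u) (C := C * C) fun u => by
      rw [abs_mul]
      exact mul_le_mul (abs_interaction_le h s x ℓ u) (abs_interaction_le h s x k u)
        (abs_nonneg _) h.nonneg
  have h4 := mul_le_mul h1 h2 (abs_nonneg _) h.nonneg
  rw [← abs_mul] at h4
  rw [interactionCov_eq h hs]
  refine (abs_sub _ _).trans ?_
  linarith

theorem measurable_interactionCov (h : IsRegular A B₀ B C) (hs : s ∈ D) (θ : S → S → ℝ)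
    (ℓ k : S) : Measurable (interactionCov ρ A B₀ B D θ s ℓ k) := by
  rw [funext (interactionCov_eq (ρ := ρ) h hs θ ℓ k)]
  exact (measurable_integral_approxLaw h hs θ
      (g := fun x u => interaction B s x ℓ u * interaction B s x k u)
      ((measurable_interaction_uncurry h s ℓ).mul (measurable_interaction_uncurry h s k))).sub
    ((measurable_integral_approxLaw h hs θ (g := fun x => interaction B s x ℓ)
      (measurable_interaction_uncurry h s ℓ)).mul
    (measurable_integral_approxLaw h hs θ (g := fun x => interaction B s x k)
      (measurable_interaction_uncurry h s k)))

theorem condVariance_eq_sum (h : IsRegular A B₀ B C) (hs : s ∈ D) (θ' θ : S → S → ℝ)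
    (x : S → X) : condVariance ρ A B₀ B D θ' θ s x =
      ∑ ℓ ∈ D, ∑ k ∈ D, θ s ℓ * θ s k * interactionCov ρ A B₀ B D θ' s ℓ k x := by
  have := isProbabilityMeasure_approxLaw (ρ := ρ) h hs θ' x
  have h1 : condVariance ρ A B₀ B D θ' θ s x =
      variance (fun u => ∑ ℓ ∈ D, (fun u => θ s ℓ * interaction B s x ℓ u) u)
        (approxLaw ρ A B₀ B D θ' s x) := rfl
  rw [h1, variance_fun_sum' fun ℓ _ => (memLp_interaction h hs θ' x ℓ).const_mul (θ s ℓ)]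
  refine Finset.sum_congr rfl fun ℓ _ => Finset.sum_congr rfl fun k _ => ?_
  rw [covariance_const_mul_left, covariance_const_mul_right, interactionCov]
  ring

/-- The exponent is affine in the network, and the increment of the log-normalizer is the
log-Laplace transform, under the law at `θ`, of the perturbation `g`. The quadratic lower bound for
that transform gives the claim, with the variance taken at `θ` and at no intermediate network. -/
theorem log_approxCond_add_sub_le (h : IsRegular A B₀ B C) (hs : s ∈ D) (θ δ : S → S → ℝ)
    {M : ℝ} (hM : (∑ ℓ ∈ D, |δ s ℓ|) * C ≤ M) (x : S → X) :
    Real.log (approxCond ρ A B₀ B D (θ + δ) s x (x s)) -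
      Real.log (approxCond ρ A B₀ B D θ s x (x s)) ≤
      (∑ ℓ ∈ D, δ s ℓ * score ρ A B₀ B D θ s ℓ x) -
        curvConst M * condVariance ρ A B₀ B D θ δ s x := by
  have hprob := isProbabilityMeasure_approxLaw (ρ := ρ) h hs θ x
  set g : X → ℝ := fun u => ∑ ℓ ∈ D, δ s ℓ * interaction B s x ℓ u with hg
  have hgm : Measurable g :=
    Finset.measurable_sum _ fun ℓ _ => (measurable_interaction h s x ℓ).const_mul _
  have hgM : ∀ u, |g u| ≤ M := fun u => (abs_sum_mul_interaction_le h D δ s x u).trans hM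
  have hadd : ∀ u, approxExponent A B D (θ + δ) s x u = approxExponent A B D θ s x u + g u :=
    fun u => by
      simp only [approxExponent, hg, Pi.add_apply, add_mul, Finset.sum_add_distrib, add_assoc]
  have hpos : ∀ θ', 0 < ∫ v, Real.exp (approxExponent A B D θ' s x v) ∂ρ := fun θ' =>
    integral_exp_pos (integrable_exp_approxExponent h θ' x)
  have hlog : ∀ θ', Real.log (approxCond ρ A B₀ B D θ' s x (x s)) =
      approxExponent A B D θ' s x (x s) -
        Real.log (∫ v, Real.exp (approxExponent A B D θ' s x v) ∂ρ) := fun θ' => by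
    rw [approxCond_eq h hs, Real.log_div (Real.exp_pos _).ne' (hpos θ').ne', Real.log_exp]
  have hbreg := integral_add_curvConst_mul_variance_le
    (ν := approxLaw ρ A B₀ B D θ s x) hgm hgM
  have hZ : Real.log (∫ u, Real.exp (g u) ∂(approxLaw ρ A B₀ B D θ s x)) =
      Real.log (∫ v, Real.exp (approxExponent A B D (θ + δ) s x v) ∂ρ) -
      Real.log (∫ v, Real.exp (approxExponent A B D θ s x v) ∂ρ) := by
    rw [approxLaw_eq_tilted h hs, integral_exp_tilted, ← Real.log_div (hpos _).ne' (hpos _).ne']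
    simp only [Pi.add_apply, hadd]
  have hvar : variance g (approxLaw ρ A B₀ B D θ s x) = condVariance ρ A B₀ B D θ δ s x := rfl
  have hmean : ∑ ℓ ∈ D, δ s ℓ * score ρ A B₀ B D θ s ℓ x =
      g (x s) - ∫ u, g u ∂(approxLaw ρ A B₀ B D θ s x) := by
    rw [hg, integral_finsetSum _ fun ℓ _ =>
      (integrable_of_abs_le (measurable_interaction h s x ℓ)
        (abs_interaction_le h s x ℓ)).const_mul (δ s ℓ), ← Finset.sum_sub_distrib]
    refine Finset.sum_congr rfl fun ℓ _ => ?_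
    rw [integral_const_mul, score, interaction_apply]; ring
  rw [hlog, hlog, hadd, hmean]
  rw [hZ, hvar] at hbreg
  linarith

end Stat

end Approx

end Model

/-! ### Disintegration of the field along its true conditional laws. -/

section FullConditional

variable {X S : Type*} [MeasurableSpace X]
variable {A B₀ : X → ℝ} {B : X → X → ℝ} {C : ℝ} {ρ : Measure X} {μ : Measure (S → X)}
  {θ : S → S → ℝ}

/-- The exponent in the full conditional density. -/
noncomputable def fullExponent (A B₀ : X → ℝ) (B : X → X → ℝ) (θ : S → S → ℝ) (s : S)
    (x : S → X) (u : X) : ℝ :=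
  A u + θ s s * B₀ u + ∑' ℓ : {ℓ // ℓ ≠ s}, θ s ℓ * B u (x ℓ)

theorem abs_mul_interaction_le (h : IsRegular A B₀ B C) (s ℓ : S) (u y : X) :
    |θ s ℓ * B u y| ≤ C * |θ s ℓ| := by
  rw [abs_mul, mul_comm]
  exact mul_le_mul_of_nonneg_right (h.abs_B _ _) (abs_nonneg _)

theorem summable_mul_interaction (h : IsRegular A B₀ B C) (hθ : θ ∈ matrixSpace S) (s : S)
    (x : S → X) (u : X) : Summable fun ℓ : {ℓ // ℓ ≠ s} => θ s ℓ * B u (x ℓ) :=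
  Summable.of_norm_bounded ((hθ.2 s).mul_left C) fun ℓ => abs_mul_interaction_le h s ℓ u _

theorem abs_fullExponent_le (h : IsRegular A B₀ B C) (hθ : θ ∈ matrixSpace S) (s : S)
    (x : S → X) (u : X) : |fullExponent A B₀ B θ s x u| ≤
      C + |θ s s| * C + C * ∑' ℓ : {ℓ // ℓ ≠ s}, |θ s ℓ| := by
  refine (abs_add_le _ _).trans (add_le_add ((abs_add_le _ _).trans
    (add_le_add (h.abs_A u) ?_)) ?_)
  · rw [abs_mul]
    exact mul_le_mul_of_nonneg_left (h.abs_B₀ u) (abs_nonneg _)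
  · rw [← tsum_mul_left, ← Real.norm_eq_abs]
    refine tsum_of_norm_bounded (((hθ.2 s).mul_left C).hasSum) fun ℓ => ?_
    exact abs_mul_interaction_le h s ℓ u (x ℓ)

theorem measurable_tsum_real {E ι : Type*} [MeasurableSpace E] [Countable ι] {f : ι → E → ℝ}
    (hf : ∀ i, Measurable (f i)) (hs : ∀ x, Summable fun i => f i x) :
    Measurable fun x => ∑' i, f i x :=
  measurable_of_tendsto_metrizable' atTop
    (f := fun (t : Finset ι) x => ∑ i ∈ t, f i x) (fun t => Finset.measurable_sum t fun i _ => hf i)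
    (tendsto_pi_nhds.2 fun x => (hs x).hasSum)

theorem fullCond_nonneg (s : S) (x : S → X) (u : X) : 0 ≤ fullCond ρ A B₀ B θ s x u :=
  div_nonneg (Real.exp_pos _).le (integral_nonneg fun _ => (Real.exp_pos _).le)

/-- The conditional law of the state at `s` given the other ones. -/
noncomputable def fullLaw (ρ : Measure X) (A B₀ : X → ℝ) (B : X → X → ℝ) (θ : S → S → ℝ) (s : S)
    (x : S → X) : Measure X := ρ.tilted (fullExponent A B₀ B θ s x)

theorem fullLaw_apply (s : S) (x : S → X)
    {E : Set X} (hE : MeasurableSet E) :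
    fullLaw ρ A B₀ B θ s x E = ENNReal.ofReal (∫ u in E, fullCond ρ A B₀ B θ s x u ∂ρ) :=
  tilted_apply_eq_ofReal_integral' _ hE

variable [Countable S]

theorem measurable_fullExponent_uncurry (h : IsRegular A B₀ B C) (hθ : θ ∈ matrixSpace S) (s : S) :
    Measurable fun p : (S → X) × X => fullExponent A B₀ B θ s p.1 p.2 := by
  refine ((h.measurable_A.comp measurable_snd).add
    ((h.measurable_B₀.comp measurable_snd).const_mul _)).add ?_
  refine measurable_tsum_real (fun ℓ => ?_) fun p => summable_mul_interaction h hθ s p.1 p.2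
  exact (h.measurable_B.comp
    (measurable_snd.prodMk ((measurable_pi_apply (ℓ : S)).comp measurable_fst))).const_mul _

theorem measurable_fullExponent (h : IsRegular A B₀ B C) (hθ : θ ∈ matrixSpace S) (s : S)
    (x : S → X) : Measurable (fullExponent A B₀ B θ s x) :=
  (measurable_fullExponent_uncurry h hθ s).comp measurable_prodMk_left

section

variable [IsFiniteMeasure ρ]

theorem integrable_exp_fullExponent (h : IsRegular A B₀ B C) (hθ : θ ∈ matrixSpace S) (s : S)
    (x : S → X) : Integrable (fun u => Real.exp (fullExponent A B₀ B θ s x u)) ρ :=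
  integrable_exp_of_abs_le (measurable_fullExponent h hθ s x) (abs_fullExponent_le h hθ s x)

theorem measurable_fullCond_uncurry (h : IsRegular A B₀ B C) (hθ : θ ∈ matrixSpace S) (s : S) :
    Measurable fun p : (S → X) × X => fullCond ρ A B₀ B θ s p.1 p.2 := by
  have hE : Measurable fun p : (S → X) × X => Real.exp (fullExponent A B₀ B θ s p.1 p.2) :=
    Real.measurable_exp.comp (measurable_fullExponent_uncurry h hθ s)
  have hZ : Measurable fun x => ∫ v, Real.exp (fullExponent A B₀ B θ s x v) ∂ρ :=
    (hE.stronglyMeasurable.integral_prod_right (ν := ρ)).measurable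
  exact hE.div (hZ.comp measurable_fst)

theorem isProbabilityMeasure_fullLaw [NeZero ρ] (h : IsRegular A B₀ B C)
    (hθ : θ ∈ matrixSpace S) (s : S) (x : S → X) :
    IsProbabilityMeasure (fullLaw ρ A B₀ B θ s x) :=
  isProbabilityMeasure_tilted (integrable_exp_fullExponent h hθ s x)

theorem measurable_fullLaw (h : IsRegular A B₀ B C) (hθ : θ ∈ matrixSpace S) (s : S) :
    Measurable (fullLaw ρ A B₀ B θ s) := by
  refine Measure.measurable_of_measurable_coe _ fun E hE => ?_
  simp_rw [fullLaw_apply s _ hE]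
  exact ENNReal.measurable_ofReal.comp
    ((measurable_fullCond_uncurry h hθ s).stronglyMeasurable.integral_prod_right
      (ν := ρ.restrict E)).measurable

/-- The integral of a function of the state at `s` and the other states is obtained by integrating
first with respect to the full conditional law. -/
theorem IsAutoModel.integral_eq [NeZero ρ] (hμ : IsAutoModel ρ A B₀ B θ μ)
    (h : IsRegular A B₀ B C) (hθ : θ ∈ matrixSpace S) (s : S)
    {g : X → ({ℓ // ℓ ≠ s} → X) → ℝ} (hg : Measurable (Function.uncurry g)) {G : ℝ}
    (hG : ∀ u y, |g u y| ≤ G) :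
    ∫ x, g (x s) (fun ℓ => x ℓ) ∂μ =
      ∫ x, ∫ u, g u (fun ℓ => x ℓ) ∂(fullLaw ρ A B₀ B θ s x) ∂μ := by
  have := hμ.1
  let R : (S → X) → ({ℓ // ℓ ≠ s} → X) := fun x ℓ => x ℓ
  have hR : Measurable R := measurable_pi_lambda _ fun ℓ => measurable_pi_apply (ℓ : S)
  let κ : Kernel (S → X) X := ⟨fullLaw ρ A B₀ B θ s, measurable_fullLaw h hθ s⟩
  have hκ : IsMarkovKernel κ := ⟨fun x => isProbabilityMeasure_fullLaw h hθ s x⟩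
  let f₁ : (S → X) → X × ({ℓ // ℓ ≠ s} → X) := fun x => (x s, R x)
  have hf₁ : Measurable f₁ := (measurable_pi_apply s).prodMk hR
  let f₂ : (S → X) × X → X × ({ℓ // ℓ ≠ s} → X) := fun p => (p.2, R p.1)
  have hf₂ : Measurable f₂ := measurable_snd.prodMk (hR.comp measurable_fst)
  -- Resampling the state at `s` from its conditional law preserves the joint law of that state and
  -- the rest. It is enough to check rectangles `E ×ˢ F`, where this is the integral over `R ⁻¹' F`
  -- of the conditional probability of `E`.
  have hmeas : μ.map f₁ = (μ.compProd κ).map f₂ := by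
    have : IsProbabilityMeasure (μ.map f₁) := Measure.isProbabilityMeasure_map hf₁.aemeasurable
    refine Measure.ext_prod fun {E F} hE hF => ?_
    rw [Measure.map_apply hf₁ (hE.prod hF), Measure.map_apply hf₂ (hE.prod hF)]
    have e₁ : f₁ ⁻¹' (E ×ˢ F) = (fun x : S → X => x s) ⁻¹' E ∩ R ⁻¹' F := rfl
    have e₂ : f₂ ⁻¹' (E ×ˢ F) = (R ⁻¹' F) ×ˢ E := by
      ext p; simp [f₂, and_comm]
    have hE' : MeasurableSet ((fun x : S → X => x s) ⁻¹' E) := measurable_pi_apply s hE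
    rw [e₁, e₂, Measure.compProd_apply_prod (hR hF) hE]
    have hle : MeasurableSpace.comap R inferInstance ≤ MeasurableSpace.pi := hR.comap_le
    have hce := setIntegral_condExp (μ := μ) hle
      (f := Set.indicator ((fun x : S → X => x s) ⁻¹' E) fun _ => (1 : ℝ))
      ((integrable_const 1).indicator hE') ⟨F, hF, rfl⟩
    rw [setIntegral_congr_ae (hR hF) ((hμ.2 s E hE).mono fun x hx _ => hx),
      setIntegral_indicator hE'] at hce
    simp only [integral_const, smul_eq_mul, mul_one] at hce
    rw [measureReal_restrict_apply_univ] at hce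
    have hκE : ∀ x, κ x E = ENNReal.ofReal (∫ u in E, fullCond ρ A B₀ B θ s x u ∂ρ) :=
      fun x => fullLaw_apply s x hE
    have hle1 : ∀ x, ∫ u in E, fullCond ρ A B₀ B θ s x u ∂ρ ≤ 1 := fun x => by
      have h1 : κ x E ≤ 1 := prob_le_one
      rw [hκE, ENNReal.ofReal_le_one] at h1
      exact h1
    have hm : Measurable fun x => ∫ u in E, fullCond ρ A B₀ B θ s x u ∂ρ :=
      ((measurable_fullCond_uncurry h hθ s).stronglyMeasurable.integral_prod_right
        (ν := ρ.restrict E)).measurable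
    simp_rw [hκE]
    have hnn : ∀ x, 0 ≤ ∫ u in E, fullCond ρ A B₀ B θ s x u ∂ρ :=
      fun x => integral_nonneg fun u => fullCond_nonneg s x u
    rw [← ofReal_integral_eq_lintegral_ofReal
      (integrable_of_abs_le hm fun x => by rw [abs_of_nonneg (hnn x)]; exact hle1 x)
      (ae_of_all _ hnn), hce, ofReal_measureReal, Set.inter_comm]
  have e₁ := integral_map (μ := μ) hf₁.aemeasurable (f := Function.uncurry g)
    hg.aestronglyMeasurable
  have e₂ := integral_map (μ := μ.compProd κ) hf₂.aemeasurable (f := Function.uncurry g)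
    hg.aestronglyMeasurable
  rw [hmeas, e₂, Measure.integral_compProd] at e₁
  · exact e₁.symm
  · exact integrable_of_abs_le (hg.comp hf₂) fun p => hG _ _

end

end FullConditional

/-! ### Bias of the score caused by the unobserved nodes. -/

section Bias

/-- The total strength of the connections of `s` to nodes outside `D`. -/
noncomputable def outsideStrength {S : Type*} (D : Finset S) (θ : S → S → ℝ) (s : S) : ℝ :=
  ∑' ℓ : (nbhd θ s \ (D : Set S) : Set S), |θ s ℓ|

theorem outsideStrength_nonneg {S : Type*} (D : Finset S) (θ : S → S → ℝ) (s : S) :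
    0 ≤ outsideStrength D θ s := tsum_nonneg fun _ => abs_nonneg _

/-- Interior rows carry no bias; this is why only the degrees of boundary rows enter the rate. -/
theorem outsideStrength_eq_zero {S : Type*} {D : Finset S} {θ : S → S → ℝ} {s : S} (hs : s ∈ D) (h : s ∉ boundary D θ) :
    outsideStrength D θ s = 0 := by
  have : nbhd θ s \ (D : Set S) = ∅ := by
    by_contra hne
    exact h ⟨hs, Set.nonempty_iff_ne_empty.2 hne⟩
  rw [outsideStrength, this]
  exact tsum_empty

theorem summable_outside {S : Type*} {D : Finset S} {θ : S → S → ℝ} {s : S}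
    (hθ : θ ∈ matrixSpace S) : Summable fun ℓ : (nbhd θ s \ (D : Set S) : Set S) => |θ s ℓ| :=
  (hθ.2 s).comp_injective (i := fun ℓ : (nbhd θ s \ (D : Set S) : Set S) =>
    (⟨ℓ, ℓ.2.1.1⟩ : {ℓ // ℓ ≠ s})) fun _ _ hab => Subtype.ext (Subtype.mk.inj hab)

variable {X S : Type*} [MeasurableSpace X]
variable {A B₀ : X → ℝ} {B : X → X → ℝ} {C : ℝ} {ρ : Measure X} {μ : Measure (S → X)}
  {θ : S → S → ℝ} {D : Finset S} {s : S}

/-- The part of the exponent of the full conditional density due to the nodes outside `D`. -/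
noncomputable def outsideExponent (B : X → X → ℝ) (D : Finset S) (θ : S → S → ℝ) (s : S)
    (x : S → X) (u : X) : ℝ :=
  ∑' ℓ : (nbhd θ s \ (D : Set S) : Set S), θ s ℓ * B u (x ℓ)

theorem abs_outsideExponent_le (h : IsRegular A B₀ B C) (hθ : θ ∈ matrixSpace S) (x : S → X)
    (u : X) : |outsideExponent B D θ s x u| ≤ C * outsideStrength D θ s := by
  rw [outsideStrength, ← tsum_mul_left, ← Real.norm_eq_abs]
  refine tsum_of_norm_bounded ((summable_outside hθ).mul_left C).hasSum fun ℓ => ?_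
  exact abs_mul_interaction_le h s ℓ u (x ℓ)

variable [LinearOrder S]

/-- The nodes other than `s` split into those in `D` and those outside; outside, the non-neighbors
contribute zero. Hence the full law is the approximate law tilted by `outsideExponent`. -/
theorem fullExponent_eq_add (h : IsRegular A B₀ B C) (hθ : θ ∈ matrixSpace S) (hs : s ∈ D)
    (x : S → X) : fullExponent A B₀ B θ s x =
      approxExponent A B D (trunc D θ) s x + outsideExponent B D θ s x := by
  ext u
  have hsum : Summable fun ℓ : {ℓ // ℓ ≠ s} => θ s ℓ * B u (x ℓ) :=
    summable_mul_interaction h hθ s x u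
  have h1 : ∑' ℓ : {ℓ // ℓ ≠ s}, θ s ℓ * B u (x ℓ) =
      ∑ ℓ ∈ D.erase s, θ s ℓ * B u (x ℓ) + outsideExponent B D θ s x u := by
    have hind : Set.indicator {ℓ | ℓ ≠ s} (fun ℓ => θ s ℓ * B u (x ℓ)) = fun ℓ =>
        Set.indicator (D.erase s : Set S) (fun ℓ => θ s ℓ * B u (x ℓ)) ℓ +
        Set.indicator (nbhd θ s \ (D : Set S)) (fun ℓ => θ s ℓ * B u (x ℓ)) ℓ := by
      ext ℓ
      by_cases h1 : ℓ = s <;> by_cases h2 : ℓ ∈ D <;> by_cases h3 : θ s ℓ = 0 <;>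
        simp [Set.indicator, nbhd, h1, h2, h3]
    have e1 : ∑' ℓ : {ℓ // ℓ ≠ s}, θ s ℓ * B u (x ℓ) =
        ∑' ℓ, Set.indicator {ℓ | ℓ ≠ s} (fun ℓ => θ s ℓ * B u (x ℓ)) ℓ :=
      tsum_subtype {ℓ | ℓ ≠ s} fun ℓ => θ s ℓ * B u (x ℓ)
    have e2 : outsideExponent B D θ s x u =
        ∑' ℓ, Set.indicator (nbhd θ s \ (D : Set S)) (fun ℓ => θ s ℓ * B u (x ℓ)) ℓ :=
      tsum_subtype (nbhd θ s \ (D : Set S)) fun ℓ => θ s ℓ * B u (x ℓ)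
    have e3 : ∑ ℓ ∈ D.erase s, θ s ℓ * B u (x ℓ) =
        ∑' ℓ, Set.indicator (D.erase s : Set S) (fun ℓ => θ s ℓ * B u (x ℓ)) ℓ :=
      sum_eq_tsum_indicator _ _
    have s2 : Summable (Set.indicator (nbhd θ s \ (D : Set S)) fun ℓ => θ s ℓ * B u (x ℓ)) :=
      summable_subtype_iff_indicator.1 (Summable.of_norm_bounded
        ((summable_outside (D := D) (s := s) hθ).mul_left C)
        fun ℓ => abs_mul_interaction_le h s ℓ u _)
    have s3 : Summable (Set.indicator (D.erase s : Set S) fun ℓ => θ s ℓ * B u (x ℓ)) :=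
      summable_subtype_iff_indicator.1 (Finset.summable (D.erase s) _)
    rw [e1, e2, e3, hind, s3.tsum_add s2]
  have h2 : approxExponent A B D (trunc D θ) s x u =
      A u + θ s s * B₀ u + ∑ ℓ ∈ D.erase s, θ s ℓ * B u (x ℓ) := by
    rw [approxExponent, ← Finset.add_sum_erase D _ hs, interaction_self h, ← add_assoc]
    congr 1
    · simp [trunc, hs]
    · refine Finset.sum_congr rfl fun ℓ hℓ => ?_
      rw [interaction_of_ne (Finset.ne_of_mem_erase hℓ)]
      simp [trunc, hs, Finset.mem_of_mem_erase hℓ]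
  rw [fullExponent, h1, Pi.add_apply, h2]
  ring

variable [Countable S]

/-- The expected score at the truncated network is controlled by the strength of the connections
to the missing nodes. -/
theorem IsAutoModel.abs_integral_score_le [IsFiniteMeasure ρ] [NeZero ρ]
    (hμ : IsAutoModel ρ A B₀ B θ μ) (h : IsRegular A B₀ B C) (hθ : θ ∈ matrixSpace S)
    (hs : s ∈ D) (ℓ : S) :
    |∫ x, score ρ A B₀ B D (trunc D θ) s ℓ x ∂μ| ≤ 4 * (C * outsideStrength D θ s) * C := by
  have := hμ.1
  let ν : (S → X) → Measure X := approxLaw ρ A B₀ B D (trunc D θ) s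
  have hν : ∀ x, IsProbabilityMeasure (ν x) := fun x =>
    isProbabilityMeasure_approxLaw h hs (trunc D θ) x
  have hprob := fun x => isProbabilityMeasure_fullLaw (ρ := ρ) h hθ s x
  let R : (S → X) → ({ℓ // ℓ ≠ s} → X) := fun x ℓ => x ℓ
  -- The interaction is written through the states away from `s` only, as the disintegration
  -- requires; `ℓ = s` needs its own branch.
  let g : X → ({ℓ // ℓ ≠ s} → X) → ℝ := fun u y => if hne : ℓ ≠ s then B u (y ⟨ℓ, hne⟩) else B₀ u
  have gpos : ∀ hne : ℓ ≠ s, g = fun u y => B u (y ⟨ℓ, hne⟩) := fun hne => by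
    ext u y; exact dif_pos hne
  have gneg : ¬ ℓ ≠ s → g = fun u _ => B₀ u := fun hne => by
    ext u y; exact dif_neg hne
  have hg : Measurable (Function.uncurry g) := by
    by_cases hne : ℓ ≠ s
    · have hp : Measurable fun p : X × ({ℓ // ℓ ≠ s} → X) => (p.1, p.2 ⟨ℓ, hne⟩) :=
        measurable_fst.prodMk ((measurable_pi_apply _).comp measurable_snd)
      rw [gpos hne]
      exact h.measurable_B.comp hp
    · rw [gneg hne]
      exact h.measurable_B₀.comp measurable_fst
  have hgC : ∀ u y, |g u y| ≤ C := fun u y => by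
    by_cases hne : ℓ ≠ s
    · rw [gpos hne]; exact h.abs_B _ _
    · rw [gneg hne]; exact h.abs_B₀ _
  have hgi : ∀ x u, g u (R x) = interaction B s x ℓ u := fun x u => by
    by_cases hne : ℓ ≠ s
    · rw [gpos hne, interaction_of_ne hne]
    · rw [gneg hne, not_not.1 hne, interaction_self h]
  have hdis := hμ.integral_eq h hθ s hg hgC
  have hdis' : ∫ x, B (x s) (x ℓ) ∂μ =
      ∫ x, ∫ u, interaction B s x ℓ u ∂(fullLaw ρ A B₀ B θ s x) ∂μ := by
    simp_rw [← interaction_apply (B := B) s ℓ, ← hgi]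
    exact hdis
  have hBm : Measurable fun x : S → X => B (x s) (x ℓ) := measurable_apply_apply h s ℓ
  have hνm : Measurable fun x => ∫ u, interaction B s x ℓ u ∂(ν x) :=
    measurable_integral_approxLaw h hs _ (g := fun x => interaction B s x ℓ)
      (measurable_interaction_uncurry h s ℓ)
  have hνi : Integrable (fun x => ∫ u, interaction B s x ℓ u ∂(ν x)) μ :=
    integrable_of_abs_le hνm fun x => abs_integral_le_of_abs_le (abs_interaction_le h s x ℓ)
  let κ : Kernel (S → X) X := ⟨fullLaw ρ A B₀ B θ s, measurable_fullLaw h hθ s⟩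
  have hκ : IsMarkovKernel κ := ⟨hprob⟩
  have hκm : Measurable fun x => ∫ u, interaction B s x ℓ u ∂(fullLaw ρ A B₀ B θ s x) :=
    ((measurable_interaction_uncurry h s ℓ).stronglyMeasurable.integral_kernel_prod_right'
      (κ := κ)).measurable
  have hκi : Integrable (fun x => ∫ u, interaction B s x ℓ u ∂(fullLaw ρ A B₀ B θ s x)) μ :=
    integrable_of_abs_le hκm fun x => abs_integral_le_of_abs_le (abs_interaction_le h s x ℓ)
  -- The observed interaction is replaced by its mean under the full conditional law, so the bias is
  -- the average difference of one function's means under two laws that differ by a tilt.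
  have heq : ∫ x, score ρ A B₀ B D (trunc D θ) s ℓ x ∂μ =
      ∫ x, ((∫ u, interaction B s x ℓ u ∂(fullLaw ρ A B₀ B θ s x)) -
        ∫ u, interaction B s x ℓ u ∂(ν x)) ∂μ := by
    rw [integral_sub hκi hνi, ← hdis', ← integral_sub
      (integrable_of_abs_le hBm fun x => h.abs_B _ _) hνi]
    rfl
  rw [heq]
  refine abs_integral_le_of_abs_le fun x => ?_
  have htilt : fullLaw ρ A B₀ B θ s x = (ν x).tilted (outsideExponent B D θ s x) := by
    simp only [ν, fullLaw]
    rw [approxLaw_eq_tilted h hs, tilted_tilted (integrable_exp_approxExponent h _ x),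
      fullExponent_eq_add h hθ hs]
  rw [htilt]
  have hom : Measurable (outsideExponent B D θ s x) := by
    have := (measurable_fullExponent h hθ s x).sub
      (measurable_approxExponent (D := D) (s := s) h (trunc D θ) x)
    rwa [fullExponent_eq_add h hθ hs, add_sub_cancel_left] at this
  exact abs_integral_tilted_sub_le hom (mul_nonneg h.nonneg (outsideStrength_nonneg D θ s))
    (abs_outsideExponent_le h hθ x) (measurable_interaction h s x ℓ) (abs_interaction_le h s x ℓ)

end Bias

/-! ### Deterministic inequalities for sparse symmetric matrices. -/

section Matrices

/-- Entrywise errors of size `τ` cost `τ` times the squared `ℓ¹` norm of the row. Bounding one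
factor by `k` leaves an error linear in that norm, comparable with the score fluctuations. -/
theorem sum_sum_mul_ge {S : Type*} {D : Finset S} {k τ n : ℝ} {δ : S → ℝ} {V EV : S → S → ℝ}
    (hτ : 0 ≤ τ) (hδ : ∑ ℓ ∈ D, |δ ℓ| ≤ k) (hV : ∀ ℓ ∈ D, ∀ j ∈ D, |V ℓ j - n * EV ℓ j| ≤ τ) :
    n * (∑ ℓ ∈ D, ∑ j ∈ D, δ ℓ * δ j * EV ℓ j) - τ * k * ∑ ℓ ∈ D, |δ ℓ| ≤
      ∑ ℓ ∈ D, ∑ j ∈ D, δ ℓ * δ j * V ℓ j := by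
  have h1 : n * (∑ ℓ ∈ D, ∑ j ∈ D, δ ℓ * δ j * EV ℓ j) - ∑ ℓ ∈ D, ∑ j ∈ D, δ ℓ * δ j * V ℓ j ≤
      ∑ ℓ ∈ D, ∑ j ∈ D, |δ ℓ| * |δ j| * τ := by
    rw [Finset.mul_sum, ← Finset.sum_sub_distrib]
    refine Finset.sum_le_sum fun ℓ hℓ => ?_
    rw [Finset.mul_sum, ← Finset.sum_sub_distrib]
    refine Finset.sum_le_sum fun j hj => ?_
    have : n * (δ ℓ * δ j * EV ℓ j) - δ ℓ * δ j * V ℓ j = -(δ ℓ * δ j * (V ℓ j - n * EV ℓ j)) := by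
      ring
    rw [this]
    refine (neg_le_abs _).trans ?_
    rw [abs_mul, abs_mul]
    exact mul_le_mul_of_nonneg_left (hV ℓ hℓ j hj) (by positivity)
  have h2 : ∑ ℓ ∈ D, ∑ j ∈ D, |δ ℓ| * |δ j| * τ = τ * (∑ ℓ ∈ D, |δ ℓ|) * ∑ ℓ ∈ D, |δ ℓ| := by
    rw [mul_assoc, Finset.sum_mul_sum, Finset.mul_sum]
    refine Finset.sum_congr rfl fun ℓ _ => ?_
    rw [Finset.mul_sum]
    exact Finset.sum_congr rfl fun j _ => by ring
  have h3 : 0 ≤ ∑ ℓ ∈ D, |δ ℓ| := Finset.sum_nonneg fun _ _ => abs_nonneg _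
  have h4 : τ * (∑ ℓ ∈ D, |δ ℓ|) * ∑ ℓ ∈ D, |δ ℓ| ≤ τ * k * ∑ ℓ ∈ D, |δ ℓ| := by gcongr
  linarith

variable {S : Type*} [LinearOrder S] {D : Finset S}

theorem norm2_nonneg (D : Finset S) (θ : S → S → ℝ) : 0 ≤ norm2 D θ := Real.sqrt_nonneg _

theorem norm2_sq (D : Finset S) (θ : S → S → ℝ) :
    norm2 D θ ^ 2 = ∑ p ∈ pairs D, |θ p.1 p.2| ^ 2 :=
  Real.sq_sqrt (Finset.sum_nonneg fun _ _ => sq_nonneg _)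

/-- Swapping coordinates embeds the entries with `s > ℓ` into `pairs D`. -/
theorem sum_sum_le_two_mul_sum_pairs (D : Finset S) {f : S → S → ℝ} (hf : ∀ s ℓ, f s ℓ = f ℓ s)
    (h0 : ∀ s ℓ, 0 ≤ f s ℓ) : ∑ s ∈ D, ∑ ℓ ∈ D, f s ℓ ≤ 2 * ∑ p ∈ pairs D, f p.1 p.2 := by
  rw [← Finset.sum_product', ← Finset.sum_filter_add_sum_filter_not (D ×ˢ D) fun p => p.1 ≤ p.2,
    two_mul]
  refine add_le_add le_rfl ?_
  have hinj : Set.InjOn Prod.swap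
      (((D ×ˢ D).filter fun p : S × S => ¬ p.1 ≤ p.2 : Finset (S × S)) : Set (S × S)) :=
    Prod.swap_injective.injOn
  have h1 : ∑ p ∈ (D ×ˢ D).filter (fun p : S × S => ¬ p.1 ≤ p.2), f p.1 p.2 =
      ∑ p ∈ ((D ×ˢ D).filter fun p : S × S => ¬ p.1 ≤ p.2).image Prod.swap, f p.1 p.2 := by
    rw [Finset.sum_image hinj]
    exact Finset.sum_congr rfl fun p _ => hf _ _
  rw [h1]
  refine Finset.sum_le_sum_of_subset_of_nonneg (fun p hp => ?_) fun p _ _ => h0 _ _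
  obtain ⟨r, hr, rfl⟩ := Finset.mem_image.1 hp
  simp only [pairs, Finset.mem_filter, Finset.mem_product, not_le, Prod.fst_swap,
    Prod.snd_swap] at hr ⊢
  exact ⟨⟨hr.1.2, hr.1.1⟩, hr.2.le⟩

theorem sum_abs_le_sqrt_card_mul {ι : Type*} (t : Finset ι) (f : ι → ℝ) :
    ∑ i ∈ t, |f i| ≤
      Real.sqrt ((t.filter fun i => 0 < |f i|).card) * Real.sqrt (∑ i ∈ t, |f i| ^ 2) := by
  have h1 : ∑ i ∈ t.filter (fun i => 0 < |f i|), |f i| = ∑ i ∈ t, |f i| :=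
    Finset.sum_filter_of_ne fun i _ hi => lt_of_le_of_ne (abs_nonneg _) hi.symm
  have h2 : ∑ i ∈ t.filter (fun i => 0 < |f i|), |f i| ^ 2 ≤ ∑ i ∈ t, |f i| ^ 2 :=
    Finset.sum_le_sum_of_subset_of_nonneg (Finset.filter_subset _ _) fun i _ _ => sq_nonneg _
  rw [← h1, ← Real.sqrt_mul (Nat.cast_nonneg _)]
  refine Real.le_sqrt_of_sq_le (sq_sum_le_card_mul_sum_sq.trans ?_)
  exact mul_le_mul_of_nonneg_left h2 (Nat.cast_nonneg _)

theorem sum_pairs_abs_le {a : ℝ} {δ : S → S → ℝ} (hδ : δ ∈ sparse D a) :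
    ∑ p ∈ pairs D, |δ p.1 p.2| ≤ Real.sqrt a * norm2 D δ :=
  (sum_abs_le_sqrt_card_mul (pairs D) fun p => δ p.1 p.2).trans
    (mul_le_mul_of_nonneg_right (Real.sqrt_le_sqrt hδ.2) (norm2_nonneg D δ))

theorem sum_sum_abs_le {a : ℝ} {δ : S → S → ℝ} (hδ : δ ∈ sparse D a) :
    ∑ s ∈ D, ∑ ℓ ∈ D, |δ s ℓ| ≤ 2 * (Real.sqrt a * norm2 D δ) :=
  (sum_sum_le_two_mul_sum_pairs D (f := fun s ℓ => |δ s ℓ|) (fun s ℓ => by rw [hδ.1.1 s ℓ])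
    fun _ _ => abs_nonneg _).trans (mul_le_mul_of_nonneg_left (sum_pairs_abs_le hδ) two_pos.le)

theorem card_le_maxBoundaryDegree {a : ℝ} {δ θ : S → S → ℝ} (hδ : δ ∈ sparse D a) {s : S}
    (hs : s ∈ boundary D θ) :
    (D.filter fun ℓ => 0 < |δ s ℓ|).card ≤ maxBoundaryDegree D θ a := by
  refine le_csSup ⟨D.card, ?_⟩ ⟨δ, hδ, s, hs, rfl⟩
  rintro k ⟨ϑ, -, t, -, rfl⟩
  exact Finset.card_filter_le _ _

/-- Two applications of Cauchy–Schwarz: within a boundary row, whose support is bounded by the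
boundary degree, and then across rows, where the outside strengths combine into `missingStrength`.
-/
theorem sum_outsideStrength_mul_le {a : ℝ} {δ θ : S → S → ℝ} (hδ : δ ∈ sparse D a) :
    ∑ s ∈ D, outsideStrength D θ s * ∑ ℓ ∈ D, |δ s ℓ| ≤
      2 * (missingStrength D θ * Real.sqrt (maxBoundaryDegree D θ a) * norm2 D δ) := by
  set N := Real.sqrt (maxBoundaryDegree D θ a)
  have h1 : ∀ s ∈ D, outsideStrength D θ s * ∑ ℓ ∈ D, |δ s ℓ| ≤
      N * (outsideStrength D θ s * Real.sqrt (∑ ℓ ∈ D, |δ s ℓ| ^ 2)) := fun s hs => by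
    by_cases hb : s ∈ boundary D θ
    · have h2 := (sum_abs_le_sqrt_card_mul D fun ℓ => δ s ℓ).trans
        (mul_le_mul_of_nonneg_right (Real.sqrt_le_sqrt (Nat.cast_le.2
          (card_le_maxBoundaryDegree hδ hb))) (Real.sqrt_nonneg _))
      have h3 := mul_le_mul_of_nonneg_left h2 (outsideStrength_nonneg D θ s)
      linarith
    · rw [outsideStrength_eq_zero hs hb]; simp
  have h2 : ∑ s ∈ D, outsideStrength D θ s * Real.sqrt (∑ ℓ ∈ D, |δ s ℓ| ^ 2) ≤
      missingStrength D θ * Real.sqrt (∑ s ∈ D, ∑ ℓ ∈ D, |δ s ℓ| ^ 2) := by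
    have h := Real.sum_mul_le_sqrt_mul_sqrt D (outsideStrength D θ)
      fun s => Real.sqrt (∑ ℓ ∈ D, |δ s ℓ| ^ 2)
    simp_rw [Real.sq_sqrt (Finset.sum_nonneg fun _ _ => sq_nonneg _)] at h
    exact h
  have h3 : Real.sqrt (∑ s ∈ D, ∑ ℓ ∈ D, |δ s ℓ| ^ 2) ≤ 2 * norm2 D δ := by
    refine Real.sqrt_le_iff.2 ⟨by linarith [norm2_nonneg D δ], ?_⟩
    have := sum_sum_le_two_mul_sum_pairs D (f := fun s ℓ => |δ s ℓ| ^ 2)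
      (fun s ℓ => by rw [hδ.1.1 s ℓ]) fun _ _ => sq_nonneg _
    rw [← norm2_sq] at this
    nlinarith [sq_nonneg (norm2 D δ)]
  have hm : 0 ≤ missingStrength D θ := Real.sqrt_nonneg _
  have hN : 0 ≤ N := Real.sqrt_nonneg _
  calc _ ≤ ∑ s ∈ D, N * (outsideStrength D θ s * Real.sqrt (∑ ℓ ∈ D, |δ s ℓ| ^ 2)) :=
        Finset.sum_le_sum h1
    _ = N * ∑ s ∈ D, outsideStrength D θ s * Real.sqrt (∑ ℓ ∈ D, |δ s ℓ| ^ 2) := by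
        rw [Finset.mul_sum]
    _ ≤ N * (missingStrength D θ * (2 * norm2 D δ)) := by
        refine mul_le_mul_of_nonneg_left (h2.trans ?_) hN
        exact mul_le_mul_of_nonneg_left h3 hm
    _ = _ := by ring

/-- The deterministic part of the rate bound: a basic inequality with linear term `W`, quadratic
term `V` and an `ℓ¹` penalty bounds the `ℓ²` norm of a sparse error matrix. -/
theorem rate_mul_norm2_le {a α κ k τ c₁ c₂ c₃ pen : ℝ} {n : ℕ} {δ θ W : S → S → ℝ}
    {V EV : S → S → S → ℝ} (hδ : δ ∈ sparse D a) (hk : ∀ s ∈ D, ∑ ℓ ∈ D, |δ s ℓ| ≤ k)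
    (ha : 0 < a) (hL : 0 < Real.log D.card) (hκ : 0 < κ) (hk0 : 0 ≤ k) (hc₁ : 0 ≤ c₁)
    (hc₂ : 0 ≤ c₂) (hc₃ : 0 ≤ c₃) (hτ : τ = c₂ * Real.sqrt (n * Real.log D.card))
    (hpen : pen ≤ c₃ * Real.sqrt (n * Real.log D.card)) (hn : 0 < n)
    (hW : ∀ s ∈ D, ∀ ℓ ∈ D, |W s ℓ| ≤ τ + n * (c₁ * outsideStrength D θ s))
    (hV : ∀ s ∈ D, ∀ ℓ ∈ D, ∀ j ∈ D, |V s ℓ j - n * EV s ℓ j| ≤ τ)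
    (hcurv : α * norm2 D δ ^ 2 ≤ ∑ s ∈ D, ∑ ℓ ∈ D, ∑ j ∈ D, δ s ℓ * δ s j * EV s ℓ j)
    (hbasic : 0 ≤ (∑ s ∈ D, ∑ ℓ ∈ D, δ s ℓ * W s ℓ) -
      κ * (∑ s ∈ D, ∑ ℓ ∈ D, ∑ j ∈ D, δ s ℓ * δ s j * V s ℓ j) +
      pen * ∑ p ∈ pairs D, |δ p.1 p.2|) :
    rate D θ n α a * norm2 D δ ≤ (c₃ + 2 * c₂ + 2 * c₁ + 2 * κ * k * c₂) / κ := by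
  set L := Real.log D.card
  set x := norm2 D δ
  set b := missingStrength D θ
  set N := Real.sqrt (maxBoundaryDegree D θ a)
  have hx : 0 ≤ x := norm2_nonneg D δ
  have hb : 0 ≤ b := Real.sqrt_nonneg _
  have hN : 0 ≤ N := Real.sqrt_nonneg _
  have hn' : (0 : ℝ) < n := Nat.cast_pos.2 hn
  have hτ0 : 0 ≤ τ := by rw [hτ]; positivity
  -- The fluctuation part is paid for by the global sparsity `a`, the bias part by the boundary
  -- degree alone.
  have hlin : ∑ s ∈ D, ∑ ℓ ∈ D, δ s ℓ * W s ℓ ≤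
      τ * (2 * (Real.sqrt a * x)) + n * c₁ * (2 * (b * N * x)) := by
    have h1 : ∑ s ∈ D, ∑ ℓ ∈ D, δ s ℓ * W s ℓ ≤
        ∑ s ∈ D, (τ * ∑ ℓ ∈ D, |δ s ℓ| + n * c₁ * (outsideStrength D θ s * ∑ ℓ ∈ D, |δ s ℓ|)) := by
      refine Finset.sum_le_sum fun s hs => ?_
      calc _ ≤ ∑ ℓ ∈ D, |δ s ℓ| * (τ + n * (c₁ * outsideStrength D θ s)) := by
            refine Finset.sum_le_sum fun ℓ hℓ => (le_abs_self _).trans ?_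
            rw [abs_mul]
            exact mul_le_mul_of_nonneg_left (hW s hs ℓ hℓ) (abs_nonneg _)
        _ = _ := by rw [← Finset.sum_mul]; ring
    rw [Finset.sum_add_distrib, ← Finset.mul_sum, ← Finset.mul_sum] at h1
    refine h1.trans (add_le_add (mul_le_mul_of_nonneg_left (sum_sum_abs_le hδ) hτ0) ?_)
    exact mul_le_mul_of_nonneg_left (sum_outsideStrength_mul_le hδ) (by positivity)
  have hquad : n * (α * x ^ 2) - τ * k * (2 * (Real.sqrt a * x)) ≤
      ∑ s ∈ D, ∑ ℓ ∈ D, ∑ j ∈ D, δ s ℓ * δ s j * V s ℓ j := by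
    have h1 : ∑ s ∈ D, (n * (∑ ℓ ∈ D, ∑ j ∈ D, δ s ℓ * δ s j * EV s ℓ j) -
        τ * k * ∑ ℓ ∈ D, |δ s ℓ|) ≤ ∑ s ∈ D, ∑ ℓ ∈ D, ∑ j ∈ D, δ s ℓ * δ s j * V s ℓ j :=
      Finset.sum_le_sum fun s hs => sum_sum_mul_ge hτ0 (hk s hs) (hV s hs)
    rw [Finset.sum_sub_distrib, ← Finset.mul_sum, ← Finset.mul_sum] at h1
    have h2 := mul_le_mul_of_nonneg_left hcurv hn'.le
    have h3 := mul_le_mul_of_nonneg_left (sum_sum_abs_le hδ) (mul_nonneg hτ0 hk0)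
    linarith
  have hpair : pen * ∑ p ∈ pairs D, |δ p.1 p.2| ≤
      c₃ * Real.sqrt (n * L) * (Real.sqrt a * x) :=
    mul_le_mul hpen (sum_pairs_abs_le hδ) (Finset.sum_nonneg fun _ _ => abs_nonneg _)
      (by positivity)
  have hsq : Real.sqrt (n * L) = Real.sqrt n * Real.sqrt L := Real.sqrt_mul hn'.le _
  have hsqa : Real.sqrt (a * L) = Real.sqrt a * Real.sqrt L := Real.sqrt_mul ha.le _
  have hsn : Real.sqrt n * Real.sqrt n = n := Real.mul_self_sqrt hn'.le
  have hsn0 : 0 < Real.sqrt n := Real.sqrt_pos.2 hn'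
  have ha0 : 0 < Real.sqrt a := Real.sqrt_pos.2 ha
  have hL0 : 0 < Real.sqrt L := Real.sqrt_pos.2 hL
  set T := c₃ + 2 * c₂ + 2 * c₁ + 2 * κ * k * c₂ with hT
  have hden : 0 < Real.sqrt (a * L) + Real.sqrt n * b * N := by rw [hsqa]; positivity
  have hmain : κ * (n * α * x ^ 2) ≤
      Real.sqrt n * x * (T * (Real.sqrt (a * L) + Real.sqrt n * b * N)) := by
    have h1 := mul_le_mul_of_nonneg_left hquad hκ.le
    have h2 : κ * (n * α * x ^ 2) ≤
        τ * (2 * (Real.sqrt a * x)) + n * c₁ * (2 * (b * N * x)) +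
        κ * (τ * k * (2 * (Real.sqrt a * x))) + c₃ * Real.sqrt (n * L) * (Real.sqrt a * x) := by
      linarith
    refine h2.trans ?_
    rw [hτ, hsq, hsqa]
    -- These are the surplus cross terms created by using the single constant `T` for both summands
    -- of the denominator.
    have h3 : 0 ≤ Real.sqrt n * x * ((2 * c₁) * (Real.sqrt a * Real.sqrt L) +
        (c₃ + 2 * c₂ + 2 * κ * k * c₂) * (Real.sqrt n * b * N)) := by positivity
    rw [hT]
    linear_combination h3 - 2 * c₁ * b * N * x * hsn
  rcases hx.eq_or_lt with h0 | h0
  · rw [← h0, mul_zero]; positivity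
  · have h1 : κ * (Real.sqrt n * α * x) ≤ T * (Real.sqrt (a * L) + Real.sqrt n * b * N) := by
      refine le_of_mul_le_mul_left ?_ (mul_pos hsn0 h0)
      refine le_trans (le_of_eq ?_) hmain
      linear_combination κ * α * x ^ 2 * hsn
    rw [rate, div_mul_eq_mul_div, div_le_div_iff₀ hden hκ]
    linarith

end Matrices

/-! ### Lipschitz control of the penalty. -/

section Penalty

/-- Mean value theorem; right-continuity at `0` admits intervals starting at the origin. -/
theorem IsPenalty.exists_lipschitz {q : ℝ → ℝ → ℝ} (hq : IsPenalty q) : ∃ c : ℝ, 0 ≤ c ∧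
    ∀ lam, 0 < lam → ∀ x y, 0 ≤ x → 0 ≤ y → |q lam x - q lam y| ≤ c * lam * |x - y| := by
  obtain ⟨hq1, c, hc⟩ := hq
  have hc0 : 0 ≤ c := (by positivity : 0 ≤ |deriv (q 1) 1| / 1).trans (hc 1 one_pos 1 one_pos)
  refine ⟨c, hc0, fun lam hlam => ?_⟩
  obtain ⟨-, -, hcont0, hdiff⟩ := hq1 lam hlam.le
  have hlt : ∀ x y, 0 ≤ x → x < y → |q lam y - q lam x| ≤ c * lam * |y - x| := by
    intro x y hx hxy
    have hcont : ContinuousOn (q lam) (Set.Icc x y) := fun z hz => by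
      rcases (hx.trans hz.1).eq_or_lt with h0 | h0
      · rw [← h0]
        exact hcont0.mono fun w hw => hx.trans hw.1
      · exact (hdiff z h0).continuousAt.continuousWithinAt
    obtain ⟨z, hz, hzd⟩ := exists_deriv_eq_slope (q lam) hxy hcont
      fun z hz => (hdiff z (hx.trans_lt hz.1)).differentiableWithinAt
    have h1 := hc lam hlam z (hx.trans_lt hz.1)
    rw [div_le_iff₀ hlam, hzd, abs_div, div_le_iff₀ (abs_pos.2 (sub_pos.2 hxy).ne')] at h1
    exact h1
  intro x y hx hy
  rcases lt_trichotomy x y with h | h | h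
  · rw [abs_sub_comm, abs_sub_comm x]; exact hlt x y hx h
  · simp [h]
  · exact hlt y x hy h

end Penalty

/-! ### Impossibility of the curvature condition without a row-sum bound. -/

section Unbounded

variable {X S : Type*} [MeasurableSpace X] [LinearOrder S]
variable {A B₀ : X → ℝ} {B : X → X → ℝ} {C : ℝ} {ρ : Measure X} {μ : Measure (S → X)}
  {θs : S → S → ℝ} {D : Finset S}

/-- The matrix whose only nonzero entry is `t` at `(s, s)`. -/
def diagSingle (s : S) (t : ℝ) : S → S → ℝ := fun i j => if i = s ∧ j = s then t else 0

theorem diagSingle_mem_finMatrix {s : S} (hs : s ∈ D) (t : ℝ) :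
    diagSingle s t ∈ finMatrix D := by
  refine ⟨fun i j => by simp only [diagSingle, and_comm], fun i j hij => if_neg ?_⟩
  rintro ⟨rfl, rfl⟩
  exact hij ⟨hs, hs⟩

theorem sum_diagSingle_mul {s : S} (hs : s ∈ D) (t : ℝ) (f : S → ℝ) :
    ∑ ℓ ∈ D, diagSingle s t s ℓ * f ℓ = t * f s := by
  simp [diagSingle, hs]

/-- Over an unbounded parameter set, the conditional variances are not uniformly bounded below. -/
theorem not_curvatureMoment_top [IsFiniteMeasure ρ] [NeZero ρ] [IsProbabilityMeasure μ]
    (h : IsRegular A B₀ B C) (hD : D.Nonempty) {α α' : ℝ} (hα : 0 < α) :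
    ¬ CurvatureMoment ρ A B₀ B μ θs D ⊤ α α' := by
  rintro ⟨hcurv, -⟩
  obtain ⟨s, hs⟩ := hD
  -- With the network `diagSingle s k` the law at `s` ignores the configuration and is the tilt of
  -- `ρ` by `A + k B₀`. Testing the curvature in the direction `diagSingle s 1` leaves only the
  -- variance of `B₀`.
  refine not_forall_le_variance_tilted (ρ := ρ) h.measurable_A h.measurable_B₀ h.abs_A h.abs_B₀ hα
    fun k => ?_
  have h1 := hcurv (diagSingle s 1) (diagSingle_mem_finMatrix hs 1) (diagSingle s k)
    (by rw [boundedMatrix_top]; exact diagSingle_mem_finMatrix hs k)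
  have hnorm : 1 ≤ norm2 D (diagSingle s 1) ^ 2 := by
    rw [norm2_sq]
    have hmem : (s, s) ∈ pairs D := by simp [pairs, hs]
    refine le_trans (by simp [diagSingle]) (Finset.single_le_sum
      (f := fun p : S × S => |diagSingle s 1 p.1 p.2| ^ 2) (fun p _ => sq_nonneg _) hmem)
  have hvar : ∀ x : S → X, condVariance ρ A B₀ B D (diagSingle s k) (diagSingle s 1) s x =
      variance B₀ (ρ.tilted fun u => A u + k * B₀ u) := fun x => by
    have e1 : approxExponent A B D (diagSingle s k) s x = fun u => A u + k * B₀ u := by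
      ext u
      rw [approxExponent, sum_diagSingle_mul hs, interaction_self h]
    have e2 : (fun u => ∑ ℓ ∈ D, diagSingle s 1 s ℓ * B u (Function.update x s u ℓ)) = B₀ := by
      ext u
      rw [sum_diagSingle_mul hs, one_mul, Function.update_self, h.diag]
    rw [condVariance, e2, approxLaw_eq_tilted h hs, e1]
  have hzero : ∀ t ∈ D, t ≠ s →
      ∫ x, condVariance ρ A B₀ B D (diagSingle s k) (diagSingle s 1) t x ∂μ = 0 := by
    intro t _ ht
    have : ∀ x : S → X, condVariance ρ A B₀ B D (diagSingle s k) (diagSingle s 1) t x = 0 := by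
      intro x
      have e : (fun u => ∑ ℓ ∈ D, diagSingle s 1 t ℓ * B u (Function.update x t u ℓ)) = 0 := by
        ext u; simp [diagSingle, ht]
      rw [condVariance, e, variance_zero]
    simp [this]
  rw [Finset.sum_eq_single_of_mem s hs hzero] at h1
  simp only [hvar, integral_const, probReal_univ, one_smul] at h1
  nlinarith

end Unbounded

/-! ### Concentration event, basic inequality and the bound for the estimator. -/

section Estimator

theorem sum_abs_sub_le {S : Type*} {D : Finset S} {K : ENNReal} (hK : K ≠ ⊤)
    {θ₁ θ₂ : S → S → ℝ} (h₁ : θ₁ ∈ boundedMatrix D K) (h₂ : θ₂ ∈ boundedMatrix D K) {s : S} (hs : s ∈ D) :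
    ∑ ℓ ∈ D, |(θ₁ - θ₂) s ℓ| ≤ 2 * K.toReal := by
  have e₁ := (ENNReal.ofReal_le_iff_le_toReal hK).1 (h₁.2 s hs)
  have e₂ := (ENNReal.ofReal_le_iff_le_toReal hK).1 (h₂.2 s hs)
  have : ∑ ℓ ∈ D, |(θ₁ - θ₂) s ℓ| ≤ ∑ ℓ ∈ D, (|θ₁ s ℓ| + |θ₂ s ℓ|) :=
    Finset.sum_le_sum fun ℓ _ => abs_sub _ _
  rw [Finset.sum_add_distrib] at this
  linarith

theorem tendsto_card_atTop {S : Type*} [Infinite S] {D : ℕ → Finset S}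
    (hmono : Monotone D) (hcover : ∀ s, ∃ n, s ∈ D n) : Tendsto (fun n => ((D n).card : ℝ)) atTop atTop := by
  refine tendsto_natCast_atTop_atTop.comp (tendsto_atTop_atTop.2 fun m => ?_)
  obtain ⟨T, hT⟩ := Infinite.exists_subset_card_eq S m
  choose N hN using hcover
  refine ⟨T.sup N, fun n hn => ?_⟩
  rw [← hT]
  exact Finset.card_le_card fun s hs => hmono ((Finset.le_sup hs).trans hn) (hN s)

variable {X S : Type*} [MeasurableSpace X]
variable {A B₀ : X → ℝ} {B : X → X → ℝ} {C : ℝ} {ρ : Measure X} {μ : Measure (S → X)}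
  {θs : S → S → ℝ} {D : Finset S}

/-- For `ρ = 0` the conditional probability of the whole state space would be `0` instead of `1`. -/
theorem IsAutoModel.neZero [Nonempty S] (hμ : IsAutoModel ρ A B₀ B θs μ) : NeZero ρ := by
  refine ⟨fun h0 => ?_⟩
  have := hμ.1
  obtain ⟨s⟩ := ‹Nonempty S›
  have hle : MeasurableSpace.comap (fun (x : S → X) (ℓ : {ℓ // ℓ ≠ s}) => x ℓ) inferInstance ≤
      MeasurableSpace.pi :=
    (measurable_pi_lambda _ fun ℓ : {ℓ // ℓ ≠ s} => measurable_pi_apply (ℓ : S)).comap_le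
  have h1 := hμ.2 s Set.univ MeasurableSet.univ
  simp only [Set.preimage_univ, Set.indicator_univ, h0, Measure.restrict_zero,
    integral_zero_measure] at h1
  rw [condExp_const hle] at h1
  have h2 : ∀ᵐ x ∂μ, False := h1.mono fun x hx => one_ne_zero hx
  rw [eventually_false_iff_eq_bot, ae_eq_bot] at h2
  exact IsProbabilityMeasure.ne_zero μ h2

variable [LinearOrder S]

/-- The event that all the score and covariance sums are within `τ` of their means. -/
def IsConcentrated (ρ : Measure X) (A B₀ : X → ℝ) (B : X → X → ℝ) (μ : Measure (S → X))
    (D : Finset S) (θ : S → S → ℝ) (n : ℕ) (τ : ℝ) (x : ℕ → S → X) : Prop :=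
  (∀ s ∈ D, ∀ ℓ ∈ D, |∑ i ∈ Finset.range n, score ρ A B₀ B D θ s ℓ (x i) -
      n * ∫ y, score ρ A B₀ B D θ s ℓ y ∂μ| ≤ τ) ∧
  ∀ s ∈ D, ∀ ℓ ∈ D, ∀ k ∈ D, |∑ i ∈ Finset.range n, interactionCov ρ A B₀ B D θ s ℓ k (x i) -
      n * ∫ y, interactionCov ρ A B₀ B D θ s ℓ k y ∂μ| ≤ τ

/-- Union bound over `p ^ 2` scores and `p ^ 3` covariance entries. The factor `4 * R` in the
threshold makes each Hoeffding bound `2 / p ^ 8`, which leaves room to spare. -/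
theorem measure_not_isConcentrated_le [IsFiniteMeasure ρ] [NeZero ρ] (h : IsRegular A B₀ B C)
    {Ω : Type*} [MeasurableSpace Ω] {P : Measure Ω} [IsProbabilityMeasure P]
    {Y : ℕ → Ω → S → X} (hY : ∀ i, Measurable (Y i)) (hlaw : ∀ i, P.map (Y i) = μ)
    (hind : iIndepFun Y P) (θ : S → S → ℝ) {R : ℝ} (hR : 0 < R) (hR1 : 2 * C ≤ R)
    (hR2 : 2 * C ^ 2 ≤ R) {n : ℕ} (hn : 0 < n) (hD : 0 < D.card) :
    P {ω | ¬ IsConcentrated ρ A B₀ B μ D θ n (4 * R * Real.sqrt (n * Real.log D.card))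
      fun i => Y i ω} ≤ ENNReal.ofReal (4 / D.card) := by
  set p : ℝ := (D.card : ℝ) with hp
  have hp1 : 1 ≤ p := by rw [hp]; exact_mod_cast hD
  have hp0 : 0 < p := by linarith
  have hn' : (0 : ℝ) < n := Nat.cast_pos.2 hn
  have hL : 0 ≤ Real.log p := Real.log_nonneg hp1
  set τ := 4 * R * Real.sqrt (n * Real.log p) with hτ
  have hτ0 : 0 ≤ τ := by positivity
  have hexp : 2 * Real.exp (-τ ^ 2 / (2 * n * R ^ 2)) = 2 / p ^ 8 := by
    have : -τ ^ 2 / (2 * n * R ^ 2) = -((8 : ℕ) * Real.log p) := by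
      rw [hτ, mul_pow, Real.sq_sqrt (by positivity)]
      field_simp; push_cast; ring
    rw [this, Real.exp_neg, Real.exp_nat_mul, Real.exp_log hp0]
    rfl
  have hT : ∀ T : (S → X) → ℝ, Measurable T → (∀ x, |T x| ≤ R) →
      P {ω | τ ≤ |∑ i ∈ Finset.range n, T (Y i ω) - n * ∫ x, T x ∂μ|} ≤
        ENNReal.ofReal (2 / p ^ 8) := fun T hTm hTR => by
    rw [← hexp]; exact measure_abs_sum_sub_ge_le hY hlaw hind hTm hTR n hτ0
  let E₁ : S × S → Set Ω := fun a => {ω | τ ≤ |∑ i ∈ Finset.range n,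
    score ρ A B₀ B D θ a.1 a.2 (Y i ω) - n * ∫ y, score ρ A B₀ B D θ a.1 a.2 y ∂μ|}
  let E₂ : S × S × S → Set Ω := fun a => {ω | τ ≤ |∑ i ∈ Finset.range n,
    interactionCov ρ A B₀ B D θ a.1 a.2.1 a.2.2 (Y i ω) -
      n * ∫ y, interactionCov ρ A B₀ B D θ a.1 a.2.1 a.2.2 y ∂μ|}
  have hsub : {ω | ¬ IsConcentrated ρ A B₀ B μ D θ n τ fun i => Y i ω} ⊆
      (⋃ a ∈ D ×ˢ D, E₁ a) ∪ ⋃ a ∈ D ×ˢ D ×ˢ D, E₂ a := by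
    intro ω hω
    by_contra hnot
    simp only [Set.mem_union, Set.mem_iUnion, not_or, not_exists, Finset.mem_product] at hnot
    exact hω ⟨fun s hs ℓ hℓ => (not_le.1 (hnot.1 (s, ℓ) ⟨hs, hℓ⟩)).le,
      fun s hs ℓ hℓ k hk => (not_le.1 (hnot.2 (s, ℓ, k) ⟨hs, hℓ, hk⟩)).le⟩
  have h₁ : P (⋃ a ∈ D ×ˢ D, E₁ a) ≤ ENNReal.ofReal (p ^ 2 * (2 / p ^ 8)) := by
    refine (measure_biUnion_finset_le _ _).trans ((Finset.sum_le_card_nsmul _ _ _ fun a ha =>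
      hT _ (measurable_score h (Finset.mem_product.1 ha).1 θ a.2) fun x =>
        (abs_score_le h (Finset.mem_product.1 ha).1 θ a.2 x).trans hR1).trans ?_)
    rw [nsmul_eq_mul, Finset.card_product, ENNReal.ofReal_mul (by positivity),
      ← ENNReal.ofReal_natCast]
    refine mul_le_mul_left (ENNReal.ofReal_le_ofReal (le_of_eq ?_)) _
    push_cast; ring
  have h₂ : P (⋃ a ∈ D ×ˢ D ×ˢ D, E₂ a) ≤ ENNReal.ofReal (p ^ 3 * (2 / p ^ 8)) := by
    refine (measure_biUnion_finset_le _ _).trans ((Finset.sum_le_card_nsmul _ _ _ fun a ha =>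
      hT _ (measurable_interactionCov h (Finset.mem_product.1 ha).1 θ a.2.1 a.2.2) fun x =>
        (abs_interactionCov_le h (Finset.mem_product.1 ha).1 θ a.2.1 a.2.2 x).trans hR2).trans ?_)
    rw [nsmul_eq_mul, Finset.card_product, Finset.card_product, ENNReal.ofReal_mul (by positivity),
      ← ENNReal.ofReal_natCast]
    refine mul_le_mul_left (ENNReal.ofReal_le_ofReal (le_of_eq ?_)) _
    push_cast; ring
  refine (measure_mono hsub).trans ((measure_union_le _ _).trans ((add_le_add h₁ h₂).trans ?_))
  rw [← ENNReal.ofReal_add (by positivity) (by positivity)]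
  refine ENNReal.ofReal_le_ofReal ?_
  rw [← add_mul, mul_div_assoc', div_le_div_iff₀ (by positivity) hp0]
  have e2 : p ^ 2 * p ≤ p ^ 8 := by
    rw [← pow_succ]; exact pow_le_pow_right₀ hp1 (by norm_num)
  have e3 : p ^ 3 * p ≤ p ^ 8 := by
    rw [← pow_succ]; exact pow_le_pow_right₀ hp1 (by norm_num)
  linarith

/-- Puts the curvature condition in the form of a quadratic form in mean covariances, to be compared
entrywise with the empirical one. -/
theorem sum_condVariance_eq [IsFiniteMeasure ρ] [NeZero ρ] [IsProbabilityMeasure μ]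
    (h : IsRegular A B₀ B C) (θ δ : S → S → ℝ) :
    ∑ s ∈ D, ∫ x, condVariance ρ A B₀ B D θ δ s x ∂μ = ∑ s ∈ D, ∑ ℓ ∈ D, ∑ k ∈ D,
      δ s ℓ * δ s k * ∫ x, interactionCov ρ A B₀ B D θ s ℓ k x ∂μ := by
  refine Finset.sum_congr rfl fun s hs => ?_
  have hi : ∀ ℓ k, Integrable (fun x => δ s ℓ * δ s k * interactionCov ρ A B₀ B D θ s ℓ k x) μ :=
    fun ℓ k => (integrable_of_abs_le (measurable_interactionCov h hs θ ℓ k)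
      (abs_interactionCov_le h hs θ ℓ k)).const_mul _
  simp_rw [condVariance_eq_sum h hs]
  rw [integral_finsetSum _ fun ℓ _ => integrable_finsetSum _ fun k _ => hi ℓ k]
  refine Finset.sum_congr rfl fun ℓ _ => ?_
  rw [integral_finsetSum _ fun k _ => hi ℓ k]
  exact Finset.sum_congr rfl fun k _ => integral_const_mul _ _

/-- The basic inequality for a maximizer of the penalized pseudo-log-likelihood. -/
theorem basic_inequality [IsFiniteMeasure ρ] [NeZero ρ] (h : IsRegular A B₀ B C) {Θ : Set (S → S → ℝ)}
    {q : ℝ → ℝ} {pen M : ℝ} (hq : ∀ x y, 0 ≤ x → 0 ≤ y → |q x - q y| ≤ pen * |x - y|)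
    (hpen : 0 ≤ pen) {n : ℕ} {x : ℕ → S → X} {θ θhat : S → S → ℝ} (hθ : θ ∈ Θ)
    (hmax : θhat ∈ argmaxSet Θ (objective ρ A B₀ B D q n x))
    (hM : ∀ s ∈ D, (∑ ℓ ∈ D, |(θhat - θ) s ℓ|) * C ≤ M) :
    0 ≤ (∑ s ∈ D, ∑ ℓ ∈ D, (θhat - θ) s ℓ *
        ∑ i ∈ Finset.range n, score ρ A B₀ B D θ s ℓ (x i)) -
      curvConst M * (∑ s ∈ D, ∑ ℓ ∈ D, ∑ k ∈ D, (θhat - θ) s ℓ * (θhat - θ) s k *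
        ∑ i ∈ Finset.range n, interactionCov ρ A B₀ B D θ s ℓ k (x i)) +
      pen * ∑ p ∈ pairs D, |(θhat - θ) p.1 p.2| := by
  set δ := θhat - θ with hδ
  have hadd : θ + δ = θhat := by rw [hδ]; abel
  have hobj : objective ρ A B₀ B D q n x θ ≤ objective ρ A B₀ B D q n x θhat := hmax.2 hθ
  have hpair : ∑ p ∈ pairs D, q |θ p.1 p.2| - ∑ p ∈ pairs D, q |θhat p.1 p.2| ≤
      pen * ∑ p ∈ pairs D, |δ p.1 p.2| := by
    rw [← Finset.sum_sub_distrib, Finset.mul_sum]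
    refine Finset.sum_le_sum fun p _ => (le_abs_self _).trans
      ((hq _ _ (abs_nonneg _) (abs_nonneg _)).trans (mul_le_mul_of_nonneg_left ?_ hpen))
    rw [abs_sub_comm]
    exact abs_abs_sub_abs_le _ _
  have hlik : (∑ i ∈ Finset.range n, ∑ s ∈ D,
        Real.log (approxCond ρ A B₀ B D θhat s (x i) (x i s))) -
      (∑ i ∈ Finset.range n, ∑ s ∈ D, Real.log (approxCond ρ A B₀ B D θ s (x i) (x i s))) ≤
      ∑ i ∈ Finset.range n, ∑ s ∈ D, ((∑ ℓ ∈ D, δ s ℓ * score ρ A B₀ B D θ s ℓ (x i)) -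
        curvConst M * ∑ ℓ ∈ D, ∑ k ∈ D, δ s ℓ * δ s k *
          interactionCov ρ A B₀ B D θ s ℓ k (x i)) := by
    rw [← Finset.sum_sub_distrib]
    refine Finset.sum_le_sum fun i _ => ?_
    rw [← Finset.sum_sub_distrib]
    refine Finset.sum_le_sum fun s hs => ?_
    have := log_approxCond_add_sub_le (ρ := ρ) h hs θ δ (hM s hs) (x i)
    rwa [hadd, condVariance_eq_sum h hs] at this
  -- Moving the sample sum innermost separates the data-dependent `δ` from sums of i.i.d. terms when
  -- `θ` is deterministic.
  have hre : ∑ i ∈ Finset.range n, ∑ s ∈ D, ((∑ ℓ ∈ D, δ s ℓ * score ρ A B₀ B D θ s ℓ (x i)) -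
        curvConst M * ∑ ℓ ∈ D, ∑ k ∈ D, δ s ℓ * δ s k *
          interactionCov ρ A B₀ B D θ s ℓ k (x i)) =
      (∑ s ∈ D, ∑ ℓ ∈ D, δ s ℓ * ∑ i ∈ Finset.range n, score ρ A B₀ B D θ s ℓ (x i)) -
      curvConst M * (∑ s ∈ D, ∑ ℓ ∈ D, ∑ k ∈ D, δ s ℓ * δ s k *
        ∑ i ∈ Finset.range n, interactionCov ρ A B₀ B D θ s ℓ k (x i)) := by
    rw [Finset.sum_comm, Finset.mul_sum, ← Finset.sum_sub_distrib]
    refine Finset.sum_congr rfl fun s _ => ?_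
    rw [Finset.sum_sub_distrib, ← Finset.mul_sum, Finset.sum_comm]
    congr 1
    · exact Finset.sum_congr rfl fun ℓ _ => (Finset.mul_sum _ _ _).symm
    · rw [Finset.sum_comm]
      congr 1
      refine Finset.sum_congr rfl fun ℓ _ => ?_
      rw [Finset.sum_comm]
      exact Finset.sum_congr rfl fun k _ => (Finset.mul_sum _ _ _).symm
  rw [hre] at hlik
  simp only [objective] at hobj
  linarith

/-- On the concentration event, a sparse error of a maximizer is of the order of the rate. -/
theorem rate_mul_norm2_le_of_isConcentrated [IsFiniteMeasure ρ] [NeZero ρ] [Countable S]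
    (hμ : IsAutoModel ρ A B₀ B θs μ) (h : IsRegular A B₀ B C) (hθs : θs ∈ matrixSpace S)
    {K : ENNReal} (hK : K ≠ ⊤) (hθsK : trunc D θs ∈ boundedMatrix D K) {q : ℝ → ℝ}
    {pen c₂ c₃ a α α' : ℝ} {n : ℕ}
    (hq : ∀ x y, 0 ≤ x → 0 ≤ y → |q x - q y| ≤ pen * |x - y|) (hpen0 : 0 ≤ pen)
    (hpen : pen ≤ c₃ * Real.sqrt (n * Real.log D.card)) (hc₂ : 0 ≤ c₂) (hc₃ : 0 ≤ c₃)
    (ha : 0 < a) (hn : 0 < n) (hL : 0 < Real.log D.card)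
    (hcurv : CurvatureMoment ρ A B₀ B μ θs D K α α') {x : ℕ → S → X} {θhat : S → S → ℝ}
    (hmax : θhat ∈ argmaxSet (boundedMatrix D K) (objective ρ A B₀ B D q n x))
    (hδ : θhat - trunc D θs ∈ sparse D a)
    (hx : IsConcentrated ρ A B₀ B μ D (trunc D θs) n (c₂ * Real.sqrt (n * Real.log D.card)) x) :
    rate D θs n α a * norm2 D (θhat - trunc D θs) ≤
      (c₃ + 2 * c₂ + 2 * (4 * C * C) +
        2 * curvConst (2 * K.toReal * C) * (2 * K.toReal) * c₂) / curvConst (2 * K.toReal * C) := by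
  have := hμ.1
  have hrow : ∀ s ∈ D, ∑ ℓ ∈ D, |(θhat - trunc D θs) s ℓ| ≤ 2 * K.toReal :=
    fun s hs => sum_abs_sub_le hK hmax.1 hθsK hs
  have hC := h.nonneg
  refine rate_mul_norm2_le (k := 2 * K.toReal) (pen := pen) hδ hrow ha hL (curvConst_pos _)
    (by positivity) (by positivity) hc₂ hc₃ rfl hpen hn (fun s hs ℓ hℓ => ?_) hx.2 ?_
    (basic_inequality h hq hpen0 hθsK hmax
      fun s hs => mul_le_mul_of_nonneg_right (hrow s hs) hC)
  · have h1 := hx.1 s hs ℓ hℓ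
    have h2 := hμ.abs_integral_score_le h hθs hs ℓ
    have h3 := abs_add_le (∑ i ∈ Finset.range n, score ρ A B₀ B D (trunc D θs) s ℓ (x i) -
      n * ∫ y, score ρ A B₀ B D (trunc D θs) s ℓ y ∂μ)
      (n * ∫ y, score ρ A B₀ B D (trunc D θs) s ℓ y ∂μ)
    rw [sub_add_cancel, abs_mul, Nat.abs_cast] at h3
    have h4 := mul_le_mul_of_nonneg_left h2 (Nat.cast_nonneg (α := ℝ) n)
    linarith
  · rw [← sum_condVariance_eq h]
    -- Curvature is needed only with the variance taken at the truncated truth.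
    exact hcurv.1 _ hδ.1 _ hθsK

/-- Needed to turn almost sure eventual sparsity into a statement about probabilities. -/
theorem measurableSet_sparse [Countable S] (D : Finset S) (a : ℝ) :
    MeasurableSet (sparse D a) := by
  have hev : ∀ s ℓ : S, Measurable fun θ : S → S → ℝ => θ s ℓ := fun s ℓ =>
    (measurable_pi_apply ℓ).comp (measurable_pi_apply s)
  have h1 : MeasurableSet (finMatrix D) := by
    have : finMatrix D = (⋂ s, ⋂ ℓ, {θ : S → S → ℝ | θ s ℓ = θ ℓ s}) ∩
        ⋂ s, ⋂ ℓ, ⋂ _ : ¬ (s ∈ D ∧ ℓ ∈ D), {θ : S → S → ℝ | θ s ℓ = 0} := by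
      ext θ; simp [finMatrix]
    rw [this]
    exact (MeasurableSet.iInter fun s => MeasurableSet.iInter fun ℓ =>
      measurableSet_eq_fun (hev s ℓ) (hev ℓ s)).inter
      (MeasurableSet.iInter fun s => MeasurableSet.iInter fun ℓ => MeasurableSet.iInter fun _ =>
        measurableSet_eq_fun (hev s ℓ) measurable_const)
  have h2 : Measurable fun θ : S → S → ℝ =>
      (((pairs D).filter fun p => 0 < |θ p.1 p.2|).card : ℝ) := by
    simp_rw [Finset.card_filter, Nat.cast_sum]
    refine Finset.measurable_sum _ fun p _ => ?_
    have : MeasurableSet {θ : S → S → ℝ | 0 < |θ p.1 p.2|} :=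
      measurableSet_lt measurable_const (measurable_abs.comp (hev p.1 p.2))
    simp only [Nat.cast_ite, Nat.cast_one, Nat.cast_zero]
    exact Measurable.ite this measurable_const measurable_const
  exact h1.inter (measurableSet_le h2 measurable_const)

end Estimator

end AutoModel

/-! ### Assembly: boundedness in probability. -/

theorem corollary2
    {m : ℕ} (𝕏 : Set (EuclideanSpace ℝ (Fin m))) (h𝕏 : IsCompact 𝕏)
    (ρ : Measure 𝕏) [IsFiniteMeasure ρ]
    {S : Type*} [LinearOrder S] [Countable S] [Infinite S]
    (A B₀ : 𝕏 → ℝ) (B : 𝕏 → 𝕏 → ℝ)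
    (hA : Measurable A) (hB₀ : Measurable B₀) (hB : Measurable (Function.uncurry B))
    (hBsymm : ∀ x y, B x y = B y x) (hBdiag : ∀ x, B x x = B₀ x)
    (hAbdd : ∃ C, ∀ x, |A x| ≤ C) (hB₀bdd : ∃ C, ∀ x, |B₀ x| ≤ C)
    (hBbdd : ∃ C, ∀ x y, |B x y| ≤ C)
    -- the true network, its infinite-volume field and the i.i.d. sample
    (θs : S → S → ℝ) (hθs : θs ∈ AutoModel.matrixSpace S)
    (μ : Measure (S → 𝕏)) (hμ : AutoModel.IsAutoModel ρ A B₀ B θs μ)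
    {Ω : Type*} [MeasurableSpace Ω] (P : Measure Ω) [IsProbabilityMeasure P]
    (X : ℕ → Ω → S → 𝕏) (hXmeas : ∀ i, Measurable (X i)) (hXlaw : ∀ i, P.map (X i) = μ)
    (hXindep : ProbabilityTheory.iIndepFun X P)
    -- the observed domains
    (D : ℕ → Finset S) (hDmono : Monotone D) (hDcover : ∀ s, ∃ n, s ∈ D n)
    -- the parameter set: row sums at most `K`, where `K = ⊤` is no restriction
    (K : ENNReal) (hθsK : ∀ n, AutoModel.trunc (D n) θs ∈ AutoModel.boundedMatrix (D n) K)
    -- the penalty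
    (q : ℝ → ℝ → ℝ) (hq : AutoModel.IsPenalty q) (lam : ℕ → ℝ) (hlam : ∀ n, 0 < lam n)
    -- the curvature and moment conditions
    (α α' : ℕ → ℝ) (hα : ∀ n, 0 < α n) (hα' : ∀ n, 0 < α' n)
    (hcurv : ∀ᶠ n in atTop,
      AutoModel.CurvatureMoment ρ A B₀ B μ θs (D n) K (α n) (α' n))
    -- the sparsity level and the growth conditions
    (a : ℕ → ℝ) (ha : ∀ n, 0 < a n)
    (hgrowth : (fun n => a n * Real.sqrt (Real.log (D n).card))
      =O[atTop] fun n => α' n * Real.sqrt n)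
    (hlamO : lam =O[atTop] fun n => Real.sqrt (n * Real.log (D n).card))
    -- the estimator
    (θhat : ℕ → Ω → S → S → ℝ) (hθhatmeas : ∀ n, Measurable (θhat n))
    (hθhat : ∀ n, 1 ≤ n → ∀ᵐ ω ∂P, θhat n ω ∈
      AutoModel.argmaxSet (AutoModel.boundedMatrix (D n) K)
        (AutoModel.objective ρ A B₀ B (D n) (q (lam n)) n fun i => X i ω))
    (hsparse : ∀ᵐ ω ∂P, ∀ᶠ n in atTop,
      θhat n ω - AutoModel.trunc (D n) θs ∈ AutoModel.sparse (D n) (a n)) :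
    AutoModel.IsBoundedInProb P fun n ω =>
      AutoModel.rate (D n) θs n (α n) (a n) *
        AutoModel.norm2 (D n) (θhat n ω - AutoModel.trunc (D n) θs) := by
  classical
  have hprob := hμ.1
  have hρ : NeZero ρ := hμ.neZero
  obtain ⟨C₁, hC₁⟩ := hAbdd
  obtain ⟨C₂, hC₂⟩ := hB₀bdd
  obtain ⟨C₃, hC₃⟩ := hBbdd
  set C := max 0 (max C₁ (max C₂ C₃)) with hC
  have hreg : AutoModel.IsRegular A B₀ B C :=
    { measurable_A := hA
      measurable_B₀ := hB₀
      measurable_B := hB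
      diag := hBdiag
      nonneg := le_max_left _ _
      abs_A := fun x => (hC₁ x).trans (by simp [hC])
      abs_B₀ := fun x => (hC₂ x).trans (by simp [hC])
      abs_B := fun x y => (hC₃ x y).trans (by simp [hC]) }
  have hC0 : 0 ≤ C := hreg.nonneg
  have hcard := AutoModel.tendsto_card_atTop hDmono hDcover
  have hcard2 : ∀ᶠ n in atTop, (1 : ℝ) < (D n).card := hcard.eventually_gt_atTop 1
  have hK : K ≠ ⊤ := by
    rintro rfl
    obtain ⟨n, hn, hn'⟩ := (hcurv.and hcard2).exists
    have hne : (D n).Nonempty := by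
      rw [← Finset.card_pos]; exact_mod_cast zero_lt_one.trans hn'
    exact AutoModel.not_curvatureMoment_top hreg hne (hα n) hn
  obtain ⟨c, hc0, hlip⟩ := hq.exists_lipschitz
  obtain ⟨c', hc'0, hc'⟩ := hlamO.exists_nonneg
  rw [isBigOWith_iff] at hc'
  -- One positive bound for both the scores (`2 * C`) and the covariances (`2 * C ^ 2`).
  set R := 1 + 2 * C + 2 * C ^ 2 with hR
  have hR0 : 0 < R := by positivity
  have hR1 : 2 * C ≤ R := by nlinarith [sq_nonneg C]
  have hR2 : 2 * C ^ 2 ≤ R := by nlinarith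
  have hmeas : ∀ n, MeasurableSet
      {ω | θhat n ω - AutoModel.trunc (D n) θs ∈ AutoModel.sparse (D n) (a n)} := fun n => by
    have hsub : Measurable fun ω => θhat n ω - AutoModel.trunc (D n) θs :=
      measurable_pi_lambda _ fun s => measurable_pi_lambda _ fun ℓ =>
        (((measurable_pi_apply ℓ).comp (measurable_pi_apply s)).comp
          (hθhatmeas n)).sub_const (AutoModel.trunc (D n) θs s ℓ)
    exact hsub (AutoModel.measurableSet_sparse (D n) (a n))
  -- The indicators of the non-sparse events tend to zero almost surely, so their probabilities do
  -- too.
  have hlim₁ : Tendsto (fun n => P {ω | θhat n ω - AutoModel.trunc (D n) θs ∈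
      AutoModel.sparse (D n) (a n)}ᶜ) atTop (nhds 0) := by
    have := tendsto_measure_of_ae_tendsto_indicator_of_isFiniteMeasure (μ := P) atTop
      MeasurableSet.empty (fun n => (hmeas n).compl)
      (hsparse.mono fun ω hω => hω.mono fun n hn => by simpa using hn)
    simpa using this
  have hlim₂ : Tendsto (fun n => ENNReal.ofReal (4 / (D n).card)) atTop (nhds 0) := by
    have := ENNReal.tendsto_ofReal (hcard.const_div_atTop 4)
    simpa using this
  have hlim := hlim₁.add hlim₂
  rw [add_zero] at hlim
  intro ε hε
  -- The same bound serves every `ε`: it can fail only off the sparse and concentrated events, whose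
  -- complements have vanishing probability.
  refine ⟨(c * c' + 2 * (4 * R) + 2 * (4 * C * C) +
    2 * AutoModel.curvConst (2 * K.toReal * C) * (2 * K.toReal) * (4 * R)) /
      AutoModel.curvConst (2 * K.toReal * C), ?_⟩
  filter_upwards [hcurv, hcard2, hc', eventually_gt_atTop 0,
    hlim.eventually_lt_const (ENNReal.ofReal_pos.2 hε)] with n hcurvn hcardn hlamn hn hlimn
  have hL : 0 < Real.log (D n).card := Real.log_pos hcardn
  have hD0 : 0 < (D n).card := by exact_mod_cast zero_lt_one.trans hcardn
  refine le_trans ?_ hlimn.le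
  refine le_trans ?_ (add_le_add le_rfl (AutoModel.measure_not_isConcentrated_le (ρ := ρ)
    hreg hXmeas hXlaw hXindep (AutoModel.trunc (D n) θs) hR0 hR1 hR2 hn hD0))
  -- The inclusion of events holds only almost everywhere, since `θhat` is a maximizer only almost
  -- surely.
  refine le_trans (measure_mono_ae ?_) (measure_union_le _ _)
  filter_upwards [hθhat n hn] with ω hmax hω
  by_contra hnot
  have hnot' : ω ∉ {ω | θhat n ω - AutoModel.trunc (D n) θs ∈ AutoModel.sparse (D n) (a n)}ᶜ ∧
      ω ∉ {ω | ¬ AutoModel.IsConcentrated ρ A B₀ B μ (D n) (AutoModel.trunc (D n) θs) n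
        (4 * R * Real.sqrt (n * Real.log (D n).card)) fun i => X i ω} :=
    not_or.1 hnot
  have hsp : θhat n ω - AutoModel.trunc (D n) θs ∈ AutoModel.sparse (D n) (a n) :=
    not_not.1 hnot'.1
  have hconc : AutoModel.IsConcentrated ρ A B₀ B μ (D n) (AutoModel.trunc (D n) θs) n
      (4 * R * Real.sqrt (n * Real.log (D n).card)) fun i => X i ω := not_not.1 hnot'.2
  have hpen : c * lam n ≤ c * c' * Real.sqrt (n * Real.log (D n).card) := by
    rw [Real.norm_of_nonneg (hlam n).le, Real.norm_of_nonneg (Real.sqrt_nonneg _)] at hlamn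
    rw [mul_assoc]
    exact mul_le_mul_of_nonneg_left hlamn hc0
  have hfin := AutoModel.rate_mul_norm2_le_of_isConcentrated hμ hreg hθs hK (hθsK n)
    (hlip (lam n) (hlam n)) (mul_nonneg hc0 (hlam n).le) hpen (by positivity)
    (mul_nonneg hc0 hc'0) (ha n) hn hL hcurvn hmax hsp hconc
  have hnonneg : 0 ≤ AutoModel.rate (D n) θs n (α n) (a n) *
      AutoModel.norm2 (D n) (θhat n ω - AutoModel.trunc (D n) θs) := by
    have hα0 := (hα n).le
    have hms : 0 ≤ AutoModel.missingStrength (D n) θs := Real.sqrt_nonneg _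
    refine mul_nonneg ?_ (AutoModel.norm2_nonneg _ _)
    unfold AutoModel.rate
    positivity
  refine absurd hω (not_lt.2 ?_)
  rw [abs_of_nonneg hnonneg]
  exact hfin
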